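/- Let $p \ge 3$ be a prime number and let $N, n \ge 1$ be integers with $n$ coprime to $p$. Put $$\tau_{p,N} := 2(p-1)\left(\frac{\log 2}{\log 3} + \frac N2\right) + \frac{\log N}{\log 3}, \qquad \sigma_{p,n} := 2np\left(\frac{\log 2}{\log 3} + (p-1)\left(3 + \frac{2\log 2}{\log 3}\right) + 1\right),$$ both of which are positive. Let $\mathbb F$ be any finite field of characteristic $p$, and fix any embedding $\iota : \overline{\mathbb Q} \hookrightarrow \mathbb C$. For a character $\chi : \mathbb F^\times \to \overline{\mathbb Q}^\times$, an additive character $\psi : \mathbb F \to \overline{\mathbb Q}^\times$ and $\alpha \in \mathbb F^\times$, define the Gauss and Kloosterman sums $$G_{\mathbb F}(\chi,\psi) := -\sum_{x \in \mathbb F^\times} \chi(x)\psi(x), \qquad \mathrm{Kl}_{\mathbb F}(\psi,\alpha) := -\sum_{x \in \mathbb F^\times} \psi\left(x + \frac{\alpha}{x}\right).$$ Let $\varepsilon_{\mathbb F}(\chi,\psi) \in [0,2\pi)$ be the argument of $\iota(G_{\mathbb F}(\chi,\psi))$ when $\psi$ is nontrivial. Let $$R_N := \left\{\tfrac{2j\pi}{N}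 : 0 \le j \le N-1\right\}, \qquad \Gamma_{\mathbb F,n} := \{\varepsilon_{\mathbb F}(\chi,\psi') : \chi \text{ of exact order } n,\ \psi' \text{ nontrivial}\}.$$ For $x \in \mathbb R$ and a finite set $I \subset \mathbb R$ write $\operatorname{dist}(x,I) := \min_{y \in I}|x-y|$, with $\operatorname{dist}(x,\emptyset) := +\infty$. Then, for every nontrivial additive character $\psi$ on $\mathbb F$ and every $\alpha \in \mathbb F^\times$, there is a unique $\theta = \theta_{\mathbb F}(\psi,\alpha) \in [0,\pi]$ with $\iota(\mathrm{Kl}_{\mathbb F}(\psi,\alpha)) = 2\sqrt{|\mathbb F|}\cos\theta$, and it satisfies 1. $\min\{\operatorname{dist}(\theta, R_N),\ \operatorname{dist}(2\pi - \theta, R_N)\} \ge |\mathbb F|^{-\tau_{p,N}}$; 2. $\min\{\operatorname{dist}(\theta, \Gamma_{\mathbb F,n}),\ \operatorname{dist}(2\pi - \theta, \Gamma_{\mathbb F,n})\} \ge |\mathbb F|^{-\sigma_{p,n}}$. -/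

import Mathlib

noncomputable section

/-- The Gauss sum `- ∑_{x ∈ Fˣ} χ(x) ψ(x)`; a `MulChar` is a character of `Fˣ` extended by `0`. -/
def signedGaussSum {F R : Type*} [Field F] [Fintype F] [CommRing R]
    (χ : MulChar F R) (ψ : AddChar F R) : R :=
  -gaussSum χ ψ

/-- The Kloosterman sum `- ∑_{x ∈ Fˣ} ψ(x + α / x)`. -/
def kloostermanSum {F R : Type*} [Field F] [Fintype F] [DecidableEq F] [CommRing R]
    (ψ : AddChar F R) (α : Fˣ) : R :=
  -∑ x : Fˣ, ψ ((x : F) + (α : F) / (x : F))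

/-- The argument of a complex number, taken in `[0, 2π)`. -/
def argTwoPi (z : ℂ) : ℝ :=
  toIcoMod Real.two_pi_pos 0 z.arg

/-- The angle in `[0, 2π)` of the Gauss sum of `χ` and `ψ`, in the complex embedding `ι`. -/
def gaussAngle {F : Type*} [Field F] [Fintype F] (ι : AlgebraicClosure ℚ →+* ℂ)
    (χ : MulChar F (AlgebraicClosure ℚ)) (ψ : AddChar F (AlgebraicClosure ℚ)) : ℝ :=
  argTwoPi (ι (signedGaussSum χ ψ))

/-- The angle `θ ∈ [0, π]` of the Kloosterman sum, determined by `ι(Kl) = 2 √|F| cos θ`. -/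
def kloostermanAngle {F : Type*} [Field F] [Fintype F] [DecidableEq F]
    (ι : AlgebraicClosure ℚ →+* ℂ) (ψ : AddChar F (AlgebraicClosure ℚ)) (α : Fˣ) : ℝ :=
  Real.arccos ((ι (kloostermanSum ψ α)).re / (2 * √(Fintype.card F : ℝ)))

/-- The angles in `[0, 2π)` of the `N`-th roots of unity. -/
def rootOfUnityAngles (N : ℕ) : Set ℝ :=
  {y | ∃ j : ℕ, j < N ∧ y = 2 * (j : ℝ) * Real.pi / (N : ℝ)}

/-- The angles of all Gauss sums over `F` attached to a multiplicative character of exact order `n`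
and a nontrivial additive character. -/
def gaussAngles (F : Type*) [Field F] [Fintype F] (ι : AlgebraicClosure ℚ →+* ℂ) (n : ℕ) :
    Set ℝ :=
  {y | ∃ (χ : MulChar F (AlgebraicClosure ℚ)) (ψ : AddChar F (AlgebraicClosure ℚ)),
    orderOf χ = n ∧ ψ ≠ 1 ∧ y = gaussAngle ι χ ψ}

/-- The exponent `τ_{p,N}`. -/
def tauExponent (p N : ℕ) : ℝ :=
  2 * ((p : ℝ) - 1) * (Real.log 2 / Real.log 3 + (N : ℝ) / 2) + Real.log (N : ℝ) / Real.log 3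

/-- The exponent `σ_{p,n}`. -/
def sigmaExponent (p n : ℕ) : ℝ :=
  2 * (n : ℝ) * (p : ℝ) *
    (Real.log 2 / Real.log 3 + ((p : ℝ) - 1) * (3 + 2 * Real.log 2 / Real.log 3) + 1)

end

/-! Both estimates are Liouville bounds for a nonzero algebraic integer η. Put q = |F|. Modulo a
place above p every value of an additive character becomes 1, so Kl ≡ -(q - 1) ≡ 1, while q ≡ 0 and
G(χ, ψ') ≡ 0 for χ ≠ 1. For roots of unity take η = D_N(Kl, q)² - 4q^N, with D_N the Dickson
polynomial; its absolute value in each embedding is 4q^N sin²(Nθ). For Gauss sums take η = Kl - (G +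
G(χ⁻¹, ψ'⁻¹)), of absolute value 2√q |cos θ - cos ε|. In both cases η ≡ 1, so η ≠ 0. It lies in a
field generated by roots of unity of order p, respectively np, so its norm is a nonzero integer, and
bounding the other conjugates trivially bounds η from below (`one_le_norm_mul_pow_of_isIntegral`).
Since sine and cosine are 1-Lipschitz, this separates the angles. The trivial χ has G = 1 and angle
0, which is the root of unity case with N = 1.

A real θ exists in every embedding because of Weil's bound |Kl| ≤ 2√q (`abs_re_kloostermanSum_le`).
The L-function of the Kloosterman sum is 1 - Kl·T + qT² = (1 - uT)(1 - vT), so -(u^k + v^k) is the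
unsigned exponential sum over the extension of degree k. Stepanov's method
(`two_mul_card_isSquare_eval_lt`) bounds the points of y^q - y + b = x + β/x over extensions of even
degree 2s, whence |u^(2s) + v^(2s)| ≤ 2q·q^s + 1. If |Kl| > 2√q, then u and v are real and one of
u², v² exceeds q, which contradicts this for large s. -/

open Polynomial

/-! ### Stepanov's method for square values of a polynomial. -/

namespace Polynomial

variable {K : Type*} [Field K]

/-- The bivariate polynomial `∑ c k l y ^ k Y ^ l`, with `Y` the outer variable. -/
noncomputable def ofArray (A B : ℕ) : (Fin A × Fin B → K) →ₗ[K] K[X][X] where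
  toFun c := ∑ l : Fin B, ∑ k : Fin A, C (C (c (k, l)) * X ^ (k : ℕ)) * X ^ (l : ℕ)
  map_add' c d := by
    simp only [Pi.add_apply, map_add, add_mul, Finset.sum_add_distrib]
  map_smul' r c := by
    simp only [Pi.smul_apply, smul_eq_mul, map_mul, RingHom.id_apply, Finset.mul_sum,
      Algebra.smul_def, Polynomial.algebraMap_apply, Algebra.algebraMap_self, mul_assoc]

theorem ofArray_apply {A B : ℕ} (c : Fin A × Fin B → K) : ofArray A B c =
    ∑ l : Fin B, ∑ k : Fin A, C (C (c (k, l)) * X ^ (k : ℕ)) * X ^ (l : ℕ) := rfl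

theorem ofArray_coeff_coeff {A B : ℕ} (c : Fin A × Fin B → K) (k : Fin A) (l : Fin B) :
    ((ofArray A B c).coeff l).coeff k = c (k, l) := by
  rw [ofArray_apply]
  simp only [finsetSum_coeff, coeff_C_mul, coeff_X_pow]
  simp only [mul_ite, mul_one, mul_zero, Fin.val_inj]
  rw [Finset.sum_eq_single l]
  · simp [coeff_X_pow, Fin.val_inj]
  · intro b _ hb; simp [Ne.symm hb]
  · simp

theorem ofArray_injective (A B : ℕ) : Function.Injective (ofArray (K := K) A B) := by
  intro c d h
  ext ⟨k, l⟩
  rw [← ofArray_coeff_coeff c, h, ofArray_coeff_coeff]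

theorem ofArray_coeff_coeff_of_le {A B : ℕ} (c : Fin A × Fin B → K) (l k : ℕ) (hk : A ≤ k) :
    ((ofArray A B c).coeff l).coeff k = 0 := by
  rw [ofArray_apply]
  simp only [finsetSum_coeff, coeff_C_mul, coeff_X_pow]
  refine Finset.sum_eq_zero fun b _ => Finset.sum_eq_zero fun i _ => ?_
  split_ifs
  · have : k ≠ i := by have := i.2; omega
    simp [coeff_X_pow, this]
  · simp

theorem eval_X_pow_ofArray {A B : ℕ} (c : Fin A × Fin B → K) (P : ℕ) :
    eval (X ^ P) (ofArray A B c) =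
      ∑ l : Fin B, ∑ k : Fin A, C (c (k, l)) * X ^ (k + P * l : ℕ) := by
  simp only [ofArray_apply, eval_finsetSum, eval_mul, eval_C, eval_pow, eval_X, ← pow_mul, pow_add,
    mul_assoc]

/-- If all coefficients have degree below `P`, then `f(y, y ^ P) = 0` forces `f = 0`. -/
theorem eq_zero_of_eval_X_pow_eq_zero {P : ℕ} {f : K[X][X]}
    (hf : ∀ l k, P ≤ k → (f.coeff l).coeff k = 0) (h : eval (X ^ P) f = 0) : f = 0 := by
  ext j k
  rw [coeff_zero, coeff_zero]
  by_cases hk : P ≤ k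
  · exact hf j k hk
  push Not at hk
  have := congrArg (fun g => coeff g (k + P * j)) h
  simp only [coeff_zero] at this
  rw [eval_eq_sum, sum_def, finsetSum_coeff] at this
  rw [← this]
  symm
  have hP : 0 < P := by omega
  -- Exponents k + P·j with k < P determine k and j, so no other term reaches this coefficient.
  rw [Finset.sum_eq_single j]
  · rw [← pow_mul, coeff_mul_X_pow]
  · intro l _ hl
    rw [← pow_mul, coeff_mul_X_pow']
    split_ifs with hle
    · apply hf
      rcases lt_or_gt_of_ne hl with h1 | h1
      · have : P * (l + 1) ≤ P * j := Nat.mul_le_mul_left _ h1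
        rw [mul_add] at this
        omega
      · have : P * (j + 1) ≤ P * l := Nat.mul_le_mul_left _ h1
        rw [mul_add] at this
        omega
    · rfl
  · intro hj
    simp [notMem_support_iff.mp hj]

end Polynomial

namespace Polynomial

variable {K : Type*} [Field K]

theorem natDegree_coeff_mul_le {f g : K[X][X]} {m n : ℕ} (hf : ∀ l, (f.coeff l).natDegree ≤ m)
    (hg : ∀ l, (g.coeff l).natDegree ≤ n) (l : ℕ) : ((f * g).coeff l).natDegree ≤ m + n := by
  rw [coeff_mul]
  exact natDegree_sum_le_of_forall_le _ _ fun x _ =>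
    natDegree_mul_le.trans (add_le_add (hf _) (hg _))

/-- If `D` is monic and not a square in `K(X)`, then `U(y, y ^ P) + D ^ (a + 1) V(y, y ^ P)`
vanishes only for `U = V = 0`, where `P = 2 a + 1` bounds twice the degree of `U` in `y`. -/
theorem eq_zero_of_eval_add_mul_eval_eq_zero {p s a e : ℕ} [Fact p.Prime] [CharP K p]
    (hP : p ^ s = 2 * a + 1) (hae : e ≤ a) {D : K[X]} (hD : D.Monic) (hdeg : D.natDegree = 2 * e)
    (hsq : ∀ u n : K[X], u ^ 2 = D * n ^ 2 → n = 0) {U V : K[X][X]}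
    (hU : ∀ l, (U.coeff l).natDegree ≤ a) (hV : ∀ l, (V.coeff l).natDegree ≤ a - e)
    (h : eval (X ^ p ^ s) U + D ^ (a + 1) * eval (X ^ p ^ s) V = 0) : U = 0 ∧ V = 0 := by
  set D' : K[X][X] := (D.map (iterateFrobenius K p s)).map C with hD'
  have hD'm : D'.Monic := (hD.map _).map _
  have hD'eval : eval (X ^ p ^ s) D' = D ^ p ^ s := by
    rw [← map_iterateFrobenius_expand p D s, map_expand, hD', eval_map, expand_eq_comp_X_pow]
    rfl
  -- Squaring the relation gives D^(2a+2) = D·D^P, and D^P is `D'` evaluated at y^P. The y-degree of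
  -- the difference is at most 2a < P, so it vanishes as a bivariate polynomial.
  have key : U ^ 2 - C D * D' * V ^ 2 = 0 := by
    apply eq_zero_of_eval_X_pow_eq_zero (P := p ^ s)
    · intro l k hk
      apply coeff_eq_zero_of_natDegree_lt
      refine lt_of_lt_of_le ?_ (hP ▸ hk)
      rw [coeff_sub]
      have hCD : ∀ l, ((C D : K[X][X]).coeff l).natDegree ≤ 2 * e := by
        intro l
        rw [coeff_C]
        split_ifs
        · exact hdeg.le
        · simp
      have hDl : ∀ l, (D'.coeff l).natDegree ≤ 0 := by
        intro l; simp [hD']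
      have h1 := natDegree_coeff_mul_le hU hU l
      have h2 := natDegree_coeff_mul_le (natDegree_coeff_mul_le hCD hDl)
        (natDegree_coeff_mul_le hV hV) l
      rw [← pow_two] at h1 h2
      refine Nat.lt_succ_of_le ((natDegree_sub_le _ _).trans (max_le ?_ ?_)) <;> omega
    · have h3 : eval (X ^ p ^ s) U = -(D ^ (a + 1) * eval (X ^ p ^ s) V) :=
        eq_neg_of_add_eq_zero_left h
      rw [eval_sub, eval_pow, eval_mul, eval_mul, eval_C, eval_pow, hD'eval, h3, hP]
      ring
  have hV0 : V = 0 := by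
    -- `D'` is monic in Y with constant coefficients, so comparing leading coefficients in Y leaves
    -- u² = D·n², with n the leading coefficient of `V`.
    rw [← leadingCoeff_eq_zero]
    apply hsq U.leadingCoeff
    have := congrArg leadingCoeff (sub_eq_zero.mp key)
    simpa [leadingCoeff_mul, hD'm.leadingCoeff] using this
  refine ⟨?_, hV0⟩
  rw [hV0] at key
  simpa using key

/-- The polynomial `∑ c k l X ^ (P k + l)`, the value of `ofArray` at `(y, Y) = (X ^ P, X)`. -/
noncomputable def swapArray (P A B : ℕ) : (Fin A × Fin B → K) →ₗ[K] K[X] where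
  toFun c := ∑ l : Fin B, ∑ k : Fin A, C (c (k, l)) * X ^ (P * k + l : ℕ)
  map_add' c d := by
    simp only [Pi.add_apply, map_add, add_mul, Finset.sum_add_distrib]
  map_smul' r c := by
    simp only [Pi.smul_apply, smul_eq_mul, map_mul, RingHom.id_apply, Finset.mul_sum,
      smul_eq_C_mul, mul_assoc]

theorem swapArray_apply {A B : ℕ} (P : ℕ) (c : Fin A × Fin B → K) : swapArray P A B c =
    ∑ l : Fin B, ∑ k : Fin A, C (c (k, l)) * X ^ (P * k + l : ℕ) := rfl

theorem natDegree_swapArray_le (P A B : ℕ) (c : Fin (A + 1) × Fin (B + 1) → K) :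
    (swapArray P (A + 1) (B + 1) c).natDegree ≤ P * A + B := by
  rw [swapArray_apply]
  refine natDegree_sum_le_of_forall_le _ _ fun l _ =>
    natDegree_sum_le_of_forall_le _ _ fun k _ => ?_
  refine (natDegree_C_mul_X_pow_le _ _).trans ?_
  have h1 := k.2
  have h2 := l.2
  exact add_le_add (Nat.mul_le_mul_left _ (by omega)) (by omega)

theorem natDegree_eval_ofArray_le (P A B : ℕ) (c : Fin (A + 1) × Fin (B + 1) → K) :
    (eval (X ^ P) (ofArray (A + 1) (B + 1) c)).natDegree ≤ A + P * B := by
  rw [eval_X_pow_ofArray]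
  refine natDegree_sum_le_of_forall_le _ _ fun l _ =>
    natDegree_sum_le_of_forall_le _ _ fun k _ => ?_
  refine (natDegree_C_mul_X_pow_le _ _).trans ?_
  have h1 := k.2
  have h2 := l.2
  exact add_le_add (by omega) (Nat.mul_le_mul_left _ (by omega))

theorem natDegree_coeff_ofArray_le {A B : ℕ} (c : Fin (A + 1) × Fin B → K) (l : ℕ) :
    ((ofArray (A + 1) B c).coeff l).natDegree ≤ A := by
  rw [natDegree_le_iff_coeff_eq_zero]
  intro k hk
  exact ofArray_coeff_coeff_of_le c l k hk

/-- On a field of order P² the P-power map is an involution exchanging y and y^P. Values of the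
auxiliary polynomial thus become values of one with the roles of y and Y exchanged, which has much
lower degree when `A` is smaller than `B`. -/
theorem map_eval_eval_ofArray {A B P : ℕ} (φ : K →+* K) (hφ : ∀ x, φ x = x ^ P)
    (hφφ : ∀ x, φ (φ x) = x) (c : Fin A × Fin B → K) (y : K) :
    φ (eval y (eval (X ^ P) (ofArray A B fun i => φ (c i)))) = eval y (swapArray P A B c) := by
  rw [eval_X_pow_ofArray, swapArray_apply]
  simp only [eval_finsetSum, eval_mul, eval_C, eval_pow, eval_X, map_sum, map_mul, hφφ]
  refine Finset.sum_congr rfl fun l _ => Finset.sum_congr rfl fun k _ => ?_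
  congr 1
  rw [pow_add, map_mul, pow_mul, ← hφ y, map_pow, map_pow, hφφ, pow_add, pow_mul, hφ y]

open Classical in
/-- Stepanov's bound for the number of square values of a polynomial of even degree over a finite
field of square order. -/
theorem two_mul_card_isSquare_eval_lt [Fintype K] {p s a e : ℕ} [Fact p.Prime] [CharP K p]
    (hcard : Fintype.card K = (p ^ s) ^ 2) (hP : p ^ s = 2 * a + 1) (hae : e ≤ a)
    {D : K[X]} (hD : D.Monic) (hdeg : D.natDegree = 2 * e)
    (hsq : ∀ u n : K[X], u ^ 2 = D * n ^ 2 → n = 0) :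
    2 * (Finset.univ.filter fun y : K => IsSquare (D.eval y)).card <
      (p ^ s) ^ 2 + 2 * e * p ^ s := by
  set P := p ^ s with hPdef
  set φ : K →+* K := iterateFrobenius K p s with hφdef
  have hφ : ∀ x, φ x = x ^ P := fun x => rfl
  have hφφ : ∀ x, φ (φ x) = x := fun x => by
    rw [hφ, hφ, ← pow_mul, ← pow_two, ← hcard, FiniteField.pow_card]
  obtain ⟨f, rfl⟩ := Nat.exists_eq_add_of_le hae
  -- With a = e + f there are 2(a + 1)² unknown coefficients, against Pa + a + e + 1 = 2a² + 2a + e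
  -- + 1 coefficients of the image.
  let T : ((Fin (e + f + 1) × Fin (e + f + e + 1) → K) × (Fin (f + 1) × Fin (e + f + 1) → K))
      →ₗ[K] K[X] :=
    (swapArray P _ _).coprod ((LinearMap.mulLeft K (D ^ (e + f + 1))).comp (swapArray P _ _))
  have hT : ∀ c d, T (c, d) = swapArray P _ _ c + D ^ (e + f + 1) * swapArray P _ _ d := by
    intro c d; simp [T]
  have hDpow : (D ^ (e + f + 1)).natDegree = e * P + e := by
    rw [hD.natDegree_pow, hdeg, hP]; ring
  have hTdeg : ∀ c d, (T (c, d)).natDegree ≤ P * (e + f) + (e + f + e) := by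
    intro c d
    rw [hT]
    refine (natDegree_add_le _ _).trans (max_le (natDegree_swapArray_le _ _ _ _) ?_)
    refine natDegree_mul_le.trans ?_
    have := natDegree_swapArray_le P f (e + f) d
    rw [hDpow]
    nlinarith
  let T' : ((Fin (e + f + 1) × Fin (e + f + e + 1) → K) × (Fin (f + 1) × Fin (e + f + 1) → K))
      →ₗ[K] (Fin (P * (e + f) + (e + f + e) + 1) → K) :=
    LinearMap.pi fun i => (lcoeff K i).comp T
  have hker : LinearMap.ker T' ≠ ⊥ := by
    apply LinearMap.ker_ne_bot_of_finrank_lt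
    simp only [Module.finrank_prod, Module.finrank_fintype_fun_eq_card, Fintype.card_prod,
      Fintype.card_fin]
    rw [hP]
    nlinarith
  obtain ⟨⟨c, d⟩, hcd, hne⟩ := Submodule.exists_mem_ne_zero_of_ne_bot hker
  have hTcd : T (c, d) = 0 := by
    ext i
    by_cases hi : i < P * (e + f) + (e + f + e) + 1
    · exact congrFun (LinearMap.mem_ker.mp hcd) ⟨i, hi⟩
    · rw [coeff_eq_zero_of_natDegree_lt (by have := hTdeg c d; omega), coeff_zero]
  -- The coefficients are conjugated so that applying φ to a value of `A` recovers `T (c, d)`, which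
  -- is identically zero.
  set A : K[X] := eval (X ^ P) (ofArray _ _ fun i => φ (c i)) +
    D ^ (e + f + 1) * eval (X ^ P) (ofArray _ _ fun i => φ (d i)) with hA
  have hA0 : A ≠ 0 := by
    intro h0
    obtain ⟨h1, h2⟩ := eq_zero_of_eval_add_mul_eval_eq_zero (e := e) hP hae hD hdeg hsq
      (natDegree_coeff_ofArray_le _)
      (by rw [Nat.add_sub_cancel_left]; exact natDegree_coeff_ofArray_le _) h0
    have h1' := ofArray_injective _ _ (h1.trans (map_zero _).symm)
    have h2' := ofArray_injective _ _ (h2.trans (map_zero _).symm)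
    have hc : c = 0 := _root_.funext fun i => (map_eq_zero φ).mp (congrFun h1' i)
    have hd : d = 0 := _root_.funext fun i => (map_eq_zero φ).mp (congrFun h2' i)
    exact hne (by rw [hc, hd]; rfl)
  have hAdeg : A.natDegree ≤ (e + f) + P * (e + f + e) := by
    refine (natDegree_add_le _ _).trans (max_le (natDegree_eval_ofArray_le _ _ _ _) ?_)
    refine natDegree_mul_le.trans ?_
    have := natDegree_eval_ofArray_le P f (e + f) (fun i => φ (d i))
    rw [hDpow]
    nlinarith
  have hroot : ∀ y, IsSquare (D.eval y) → A.eval y = 0 := by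
    rintro y ⟨z, hz⟩
    apply φ.injective
    rw [map_zero, hA, eval_add, eval_mul, map_add, map_mul, map_eval_eval_ofArray φ hφ hφφ,
      map_eval_eval_ofArray φ hφ hφφ]
    -- If D(y) = z², then D(y)^(a+1) = z^(P+1) is a norm to the subfield of order P, so φ fixes it.
    have hz' : φ (eval y (D ^ (e + f + 1))) = eval y (D ^ (e + f + 1)) := by
      rw [eval_pow, hz, ← pow_two, ← pow_mul,
        show 2 * (e + f + 1) = P + 1 by omega, pow_succ, map_mul, ← hφ, hφφ, mul_comm]
    rw [hz', ← eval_mul, ← eval_add, ← hT, hTcd, eval_zero]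
  have hle : (Finset.univ.filter fun y : K => IsSquare (D.eval y)).card ≤ A.natDegree := by
    refine le_trans (Finset.card_le_card fun y hy => ?_) ((Multiset.toFinset_card_le _).trans
      (card_roots' A))
    rw [Finset.mem_filter] at hy
    rw [Multiset.mem_toFinset, mem_roots hA0]
    exact hroot y hy.2
  -- Twice the degree bound is 2a + 2P(a + e) = P² + 2eP - 1.
  rw [hP] at hAdeg ⊢
  nlinarith
end Polynomial

/-! ### Point counts on y^q - y + b = x + β/x. -/

namespace Polynomial

variable {K : Type*} [Field K]

theorem natDegree_X_pow_sub_X_add_C {q : ℕ} (hq : 1 < q) (b : K) :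
    (X ^ q - X + C b : K[X]).natDegree = q := by
  rw [natDegree_add_C, natDegree_sub_eq_left_of_natDegree_lt, natDegree_X_pow]
  rwa [natDegree_X, natDegree_X_pow]

theorem monic_X_pow_sub_X_add_C {q : ℕ} (hq : 1 < q) (b : K) :
    (X ^ q - X + C b : K[X]).Monic := by
  rw [sub_add]
  refine (monic_X_pow q).sub_of_left ?_
  refine lt_of_le_of_lt (degree_X_sub_C_le b) ?_
  rw [degree_X_pow]
  exact_mod_cast hq

/-- The difference of the square of a nonconstant polynomial and a nonzero constant is not a
square of a rational function. -/
theorem eq_zero_of_sq_eq_sq_sub_C_mul_sq {E : K[X]} {c : K} (h2 : (2 : K) ≠ 0) (hc : c ≠ 0)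
    (hE : E.natDegree ≠ 0) (u n : K[X]) (h : u ^ 2 = (E ^ 2 - C c) * n ^ 2) : n = 0 := by
  by_contra hn
  obtain ⟨s, rfl⟩ : n ∣ u := (UniqueFactorizationMonoid.pow_dvd_pow_iff_dvd two_ne_zero).mp
    ⟨E ^ 2 - C c, by rw [h, mul_comm]⟩
  have hs : (E - s) * (E + s) = C c := by
    have : s ^ 2 = E ^ 2 - C c := by
      apply mul_left_cancel₀ (pow_ne_zero 2 hn)
      rw [← mul_pow, h, mul_comm]
    linear_combination -this
  have hu : IsUnit ((E - s) * (E + s)) := hs ▸ isUnit_C.mpr hc.isUnit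
  obtain ⟨h1, h3⟩ := IsUnit.mul_iff.mp hu
  have h4 : (E - s + (E + s)).natDegree = 0 := by
    refine Nat.le_zero.mp ((natDegree_add_le _ _).trans ?_)
    rw [natDegree_eq_zero_of_isUnit h1, natDegree_eq_zero_of_isUnit h3, max_self]
  have h5 : E - s + (E + s) = C 2 * E := by rw [map_ofNat]; ring
  rw [h5, natDegree_C_mul h2] at h4
  exact hE h4

end Polynomial

section Kloosterman

variable {K : Type*} [Field K] [Fintype K] [DecidableEq K]

/-- The number of affine points of the curve `y ^ q - y + b = x + β / x`. -/
noncomputable def artinSchreierCard (q : ℕ) (β : Kˣ) (b : K) : ℕ :=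
  (Finset.univ.filter fun v : K × Kˣ =>
    b = (v.2 : K) + (β : K) / (v.2 : K) - (v.1 ^ q - v.1)).card

/-- For fixed y the equation is quadratic in x, so it has at most two solutions, and any solution
makes the discriminant a square. Stepanov's bound with e = q counts such y. -/
theorem artinSchreierCard_le {p s q a : ℕ} [Fact p.Prime] [CharP K p]
    (hcard : Fintype.card K = (p ^ s) ^ 2) (hP : p ^ s = 2 * a + 1) (hq : 1 < q) (hqa : q ≤ a)
    (h2 : (2 : K) ≠ 0) (β : Kˣ) (b : K) :
    artinSchreierCard q β b ≤ Fintype.card K + 2 * q * p ^ s := by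
  set E : K[X] := X ^ q - X + C b with hE
  -- The discriminant of x² - E(y)x + β; at a solution it equals (x - β/x)².
  set D : K[X] := E ^ 2 - C (4 * (β : K)) with hD
  have hEm : E.Monic := monic_X_pow_sub_X_add_C hq b
  have hEd : E.natDegree = q := natDegree_X_pow_sub_X_add_C hq b
  have hE2 : (E ^ 2).natDegree = 2 * q := by rw [hEm.natDegree_pow, hEd]
  have hDm : D.Monic := by
    refine (hEm.pow 2).sub_of_left (lt_of_le_of_lt degree_C_le ?_)
    rw [← natDegree_pos_iff_degree_pos, hE2]
    omega
  have hDd : D.natDegree = 2 * q := by rw [hD, natDegree_sub_C, hE2]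
  have h4 : 4 * (β : K) ≠ 0 := by
    refine mul_ne_zero ?_ β.ne_zero
    rw [show (4 : K) = 2 * 2 by norm_num]
    exact mul_ne_zero h2 h2
  have hst := two_mul_card_isSquare_eval_lt hcard hP hqa hDm hDd
    (eq_zero_of_sq_eq_sq_sub_C_mul_sq h2 h4 (by omega))
  rw [hcard]
  refine le_trans ?_ hst.le
  refine Finset.card_le_mul_card_image_of_maps_to (f := Prod.fst) ?_ 2 ?_
  · rintro ⟨y, x⟩ h
    simp only [Finset.mem_filter, Finset.mem_univ, true_and] at h ⊢
    refine ⟨(x : K) - β / x, ?_⟩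
    have hx := x.ne_zero
    simp only [hD, hE, eval_sub, eval_pow, eval_add, eval_X, eval_C, h]
    field_simp
    ring
  · intro y _
    rcases Finset.eq_empty_or_nonempty ((Finset.univ.filter fun v : K × Kˣ =>
        b = (v.2 : K) + (β : K) / (v.2 : K) - (v.1 ^ q - v.1)).filter fun v => v.1 = y) with h0 | h0
    · rw [h0]; simp
    · obtain ⟨⟨y', x⟩, hv⟩ := h0
      simp only [Finset.mem_filter, Finset.mem_univ, true_and] at hv
      obtain ⟨hv, rfl⟩ := hv
      refine le_trans (Finset.card_le_card (t := {(y', x), (y', β / x)}) ?_) Finset.card_le_two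
      rintro ⟨y, w⟩ hw
      simp only [Finset.mem_filter, Finset.mem_univ, true_and] at hw
      obtain ⟨hw, rfl⟩ := hw
      have hx := x.ne_zero
      have hw0 := w.ne_zero
      have h1 : (x : K) + β / x = w + β / w := by linear_combination hw - hv
      field_simp at h1
      have h3 : ((w : K) - x) * (w * x - β) = 0 := by linear_combination -h1
      simp only [Finset.mem_insert, Finset.mem_singleton, Prod.mk.injEq, true_and]
      rcases mul_eq_zero.mp h3 with h5 | h5
      · left; exact Units.ext (sub_eq_zero.mp h5)
      · right
        rw [eq_div_iff_mul_eq']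
        exact Units.ext (sub_eq_zero.mp h5)

theorem sum_artinSchreierCard_mul (q : ℕ) (β : Kˣ) (f : K → ℂ) :
    ∑ b, (artinSchreierCard q β b : ℂ) * f b =
      ∑ v : K × Kˣ, f ((v.2 : K) + (β : K) / (v.2 : K) - (v.1 ^ q - v.1)) := by
  simp only [artinSchreierCard, Finset.card_filter, Nat.cast_sum, Finset.sum_mul]
  rw [Finset.sum_comm]
  refine Finset.sum_congr rfl fun v _ => ?_
  simp

/-- A square-root bound, with a non-optimal constant, for Kloosterman sums of characters that are
trivial on the elements `y ^ q - y`. -/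
theorem norm_sum_kloosterman_le {p s q a : ℕ} [Fact p.Prime] [CharP K p]
    (hcard : Fintype.card K = (p ^ s) ^ 2) (hP : p ^ s = 2 * a + 1) (hq : 1 < q) (hqa : q ≤ a)
    (h2 : (2 : K) ≠ 0) (β : Kˣ) (Ψ : AddChar K ℂ) (hΨ : Ψ ≠ 1) (hΨq : ∀ y, Ψ (y ^ q - y) = 1) :
    ‖∑ x : Kˣ, Ψ ((x : K) + (β : K) / (x : K))‖ ≤ 2 * q * (p : ℝ) ^ s + 1 := by
  set Q : ℕ := Fintype.card K with hQ
  have hQ0 : 0 < Q := Fintype.card_pos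
  set S : ℂ := ∑ x : Kˣ, Ψ ((x : K) + (β : K) / (x : K)) with hS
  set B : ℕ := Q + 2 * q * p ^ s with hB
  have h1 : ∑ b, (artinSchreierCard q β b : ℂ) * Ψ b = Q * S := by
    rw [sum_artinSchreierCard_mul, Fintype.sum_prod_type]
    simp only [AddChar.map_sub_eq_div, hΨq, div_one]
    simp [hS, hQ]
  have h0 : ∑ b, Ψ b = 0 := AddChar.sum_eq_zero_of_ne_one hΨ
  have h3 : ∑ b : K, (artinSchreierCard q β b : ℝ) = Q * (Q - 1) := by
    have := sum_artinSchreierCard_mul q β (fun _ => 1)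
    simp only [mul_one, Finset.sum_const, Finset.card_univ, Fintype.card_prod,
      nsmul_eq_mul, Fintype.card_units, ← hQ] at this
    have h5 : ((Q - 1 : ℕ) : ℝ) = Q - 1 := by rw [Nat.cast_sub hQ0, Nat.cast_one]
    rw [← h5]
    exact_mod_cast this
  -- Subtracting the constant `B` costs nothing because Ψ sums to zero, and it makes every weight
  -- nonnegative. An upper bound on the point counts, with no lower bound, then suffices: the total
  -- weight is known exactly.
  have h6 : (Q : ℂ) * S = - ∑ b, (((B : ℝ) - artinSchreierCard q β b : ℝ) : ℂ) * Ψ b := by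
    push_cast
    simp only [sub_mul, Finset.sum_sub_distrib, ← Finset.mul_sum, h0, h1]
    ring
  have h7 : (Q : ℝ) * ‖S‖ ≤ Q * (2 * q * (p : ℝ) ^ s + 1) := by
    calc (Q : ℝ) * ‖S‖ = ‖(Q : ℂ) * S‖ := by rw [norm_mul, Complex.norm_natCast]
      _ ≤ ∑ b, ((B : ℝ) - artinSchreierCard q β b) := by
        rw [h6, norm_neg]
        refine (norm_sum_le _ _).trans (Finset.sum_le_sum fun b _ => ?_)
        rw [norm_mul, Complex.norm_real, AddChar.norm_apply, mul_one, Real.norm_of_nonneg]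
        rw [sub_nonneg]
        exact_mod_cast artinSchreierCard_le hcard hP hq hqa h2 β b
      _ = Q * (2 * q * (p : ℝ) ^ s + 1) := by
        rw [Finset.sum_sub_distrib, h3, Finset.sum_const, Finset.card_univ, ← hQ, nsmul_eq_mul, hB]
        push_cast
        ring
  have hQ' : (0 : ℝ) < Q := by exact_mod_cast hQ0
  exact le_of_mul_le_mul_left h7 hQ'

end Kloosterman

/-! ### Euler products over monic polynomials and their logarithmic derivatives. -/

section MonicPolynomials

variable (F : Type*) [Field F] [Finite F]

theorem finite_monic_natDegree_eq (d : ℕ) : {f : F[X] | f.Monic ∧ f.natDegree = d}.Finite := by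
  have : Finite (degreeLT F d) := Finite.of_equiv _ (degreeLTEquiv F d).toEquiv.symm
  exact Set.finite_coe_iff.mp (Finite.of_equiv _ (monicEquivDegreeLT (R := F) d).symm)

/-- The monic polynomials of degree `d` over a finite field. -/
noncomputable def monicsOfDegree (d : ℕ) : Finset F[X] :=
  (finite_monic_natDegree_eq F d).toFinset

variable {F}

@[simp] theorem mem_monicsOfDegree {d : ℕ} {f : F[X]} :
    f ∈ monicsOfDegree F d ↔ f.Monic ∧ f.natDegree = d := by
  simp [monicsOfDegree]

variable (F) in
open Classical in
/-- The monic irreducible polynomials of degree at most `m` over a finite field. -/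
noncomputable def monicIrreducibles (m : ℕ) : Finset F[X] :=
  ((Finset.range (m + 1)).biUnion (monicsOfDegree F)).filter Irreducible

@[simp] theorem mem_monicIrreducibles {m : ℕ} {f : F[X]} :
    f ∈ monicIrreducibles F m ↔ f.Monic ∧ Irreducible f ∧ f.natDegree ≤ m := by
  simp only [monicIrreducibles, Finset.mem_filter, Finset.mem_biUnion, Finset.mem_range,
    mem_monicsOfDegree, Nat.lt_succ_iff]
  constructor
  · rintro ⟨⟨d, hd, h1, h2⟩, h3⟩; exact ⟨h1, h3, h2 ▸ hd⟩
  · rintro ⟨h1, h3, hd⟩; exact ⟨⟨_, hd, h1, rfl⟩, h3⟩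

/-- The degree of a polynomial is the sum of the degrees of its irreducible factors. -/
theorem natDegree_eq_sum_multiplicity {m : ℕ} {f : F[X]} (hf : f ∈ monicsOfDegree F m) :
    m = ∑ P ∈ monicIrreducibles F m, multiplicity P f * P.natDegree := by
  classical
  obtain ⟨hfm, hfd⟩ := mem_monicsOfDegree.mp hf
  have hf0 := hfm.ne_zero
  let nf := UniqueFactorizationMonoid.normalizedFactors f
  have hmonic : ∀ P ∈ nf, P.Monic := fun P hP => by
    rw [← UniqueFactorizationMonoid.normalize_normalized_factor P hP]
    exact monic_normalize
      (UniqueFactorizationMonoid.irreducible_of_normalized_factor P hP).ne_zero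
  have hprod : nf.prod = f := by
    have := UniqueFactorizationMonoid.prod_normalizedFactors_eq hf0
    rw [this, hfm.normalize_eq_self]
  have hmult : ∀ P : F[X], P.Monic → Irreducible P → multiplicity P f = nf.count P := by
    intro P hP hPi
    have := UniqueFactorizationMonoid.emultiplicity_eq_count_normalizedFactors hPi hf0
    rw [hP.normalize_eq_self] at this
    exact multiplicity_eq_of_emultiplicity_eq_some this
  calc m = (nf.map natDegree).sum := by
        rw [← natDegree_multiset_prod_of_monic _ hmonic, hprod, hfd]
    _ = ∑ P ∈ nf.toFinset, nf.count P * P.natDegree := by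
        rw [Finset.sum_multiset_map_count]; simp
    _ = ∑ P ∈ monicIrreducibles F m, nf.count P * P.natDegree := by
        apply Finset.sum_subset
        · intro P hP
          rw [Multiset.mem_toFinset] at hP
          rw [mem_monicIrreducibles]
          refine ⟨hmonic P hP, UniqueFactorizationMonoid.irreducible_of_normalized_factor P hP, ?_⟩
          rw [← hfd]
          exact natDegree_le_of_dvd (UniqueFactorizationMonoid.dvd_of_mem_normalizedFactors hP) hf0
        · intro P _ hP
          rw [Multiset.mem_toFinset] at hP
          rw [Multiset.count_eq_zero_of_notMem hP, zero_mul]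
    _ = _ := by
        refine Finset.sum_congr rfl fun P hP => ?_
        obtain ⟨h1, h2, -⟩ := mem_monicIrreducibles.mp hP
        rw [hmult P h1 h2]

open Classical in
/-- The multiplicity of `P` in `f`, counted by the degrees of the powers of `P` dividing `f`. -/
theorem multiplicity_eq_card_filter {m : ℕ} {f P : F[X]} (hf : f ∈ monicsOfDegree F m)
    (hP : P ∈ monicIrreducibles F m) : multiplicity P f =
      ((Finset.Icc 1 m).filter fun k => P.natDegree ∣ k ∧ P ^ (k / P.natDegree) ∣ f).card := by
  obtain ⟨hfm, hfd⟩ := mem_monicsOfDegree.mp hf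
  obtain ⟨hPm, hPi, -⟩ := mem_monicIrreducibles.mp hP
  have hpos : 0 < P.natDegree := hPi.natDegree_pos
  have hfin : FiniteMultiplicity P f := FiniteMultiplicity.of_not_isUnit hPi.not_isUnit hfm.ne_zero
  have himage : ((Finset.Icc 1 m).filter fun k => P.natDegree ∣ k ∧ P ^ (k / P.natDegree) ∣ f) =
      (Finset.Icc 1 (multiplicity P f)).image (P.natDegree * ·) := by
    ext k
    simp only [Finset.mem_filter, Finset.mem_Icc, Finset.mem_image]
    constructor
    · rintro ⟨⟨h1, h2⟩, ⟨r, rfl⟩, h4⟩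
      rw [Nat.mul_div_cancel_left _ hpos, hfin.pow_dvd_iff_le_multiplicity] at h4
      exact ⟨r, ⟨Nat.pos_of_mul_pos_left h1, h4⟩, rfl⟩
    · rintro ⟨r, ⟨h1, h2⟩, rfl⟩
      rw [Nat.mul_div_cancel_left _ hpos]
      have h3 : P ^ r ∣ f := hfin.pow_dvd_iff_le_multiplicity.mpr h2
      refine ⟨⟨Nat.mul_pos hpos h1, ?_⟩, dvd_mul_right _ _, h3⟩
      have := natDegree_le_of_dvd h3 hfm.ne_zero
      rw [natDegree_pow, hfd] at this
      rwa [mul_comm]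
  rw [himage, Finset.card_image_of_injective _ fun _ _ h => Nat.eq_of_mul_eq_mul_left hpos h,
    Nat.card_Icc]
  omega

variable {R : Type*} [CommRing R]

open Classical in
theorem sum_monicsOfDegree_filter_dvd {Λ : F[X] → R}
    (hmul : ∀ f g : F[X], f.Monic → g.Monic → Λ (f * g) = Λ f * Λ g) {g : F[X]} (hg : g.Monic)
    {m : ℕ} (hgm : g.natDegree ≤ m) :
    ∑ f ∈ (monicsOfDegree F m).filter (g ∣ ·), Λ f =
      Λ g * ∑ f ∈ monicsOfDegree F (m - g.natDegree), Λ f := by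
  have himage : (monicsOfDegree F m).filter (g ∣ ·) =
      (monicsOfDegree F (m - g.natDegree)).image (g * ·) := by
    ext f
    simp only [Finset.mem_filter, Finset.mem_image, mem_monicsOfDegree]
    constructor
    · rintro ⟨⟨h1, h2⟩, h, rfl⟩
      have hh := hg.of_mul_monic_left h1
      refine ⟨h, ⟨hh, ?_⟩, rfl⟩
      rw [hg.natDegree_mul hh] at h2
      omega
    · rintro ⟨h, ⟨hh, h1⟩, rfl⟩
      refine ⟨⟨hg.mul hh, ?_⟩, dvd_mul_right _ _⟩
      rw [hg.natDegree_mul hh]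
      omega
  rw [himage, Finset.sum_image fun a _ b _ h => mul_left_cancel₀ hg.ne_zero h, Finset.mul_sum]
  exact Finset.sum_congr rfl fun h hh => hmul g h hg (mem_monicsOfDegree.mp hh).1

open Classical in
/-- The coefficient of degree `k` of the logarithmic derivative of the `L`-function of `Λ`. -/
noncomputable def primePowerSum (Λ : F[X] → R) (k : ℕ) : R :=
  ∑ P ∈ (monicIrreducibles F k).filter (·.natDegree ∣ k),
    (P.natDegree : R) * Λ P ^ (k / P.natDegree)

open Classical in
theorem primePowerSum_eq (Λ : F[X] → R) {k m : ℕ} (hk : 1 ≤ k) (hkm : k ≤ m) :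
    primePowerSum Λ k = ∑ P ∈ monicIrreducibles F m,
      if P.natDegree ∣ k then (P.natDegree : R) * Λ P ^ (k / P.natDegree) else 0 := by
  rw [primePowerSum, ← Finset.sum_filter]
  refine Finset.sum_congr ?_ fun _ _ => rfl
  ext P
  simp only [Finset.mem_filter, mem_monicIrreducibles]
  constructor
  · rintro ⟨⟨h1, h2, h3⟩, h4⟩; exact ⟨⟨h1, h2, h3.trans hkm⟩, h4⟩
  · rintro ⟨⟨h1, h2, h3⟩, h4⟩; exact ⟨⟨h1, h2, Nat.le_of_dvd hk h4⟩, h4⟩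

/-- The logarithmic derivative of the Euler product of a completely multiplicative function on
monic polynomials. -/
theorem natCast_mul_sum_monicsOfDegree {Λ : F[X] → R} (hone : Λ 1 = 1)
    (hmul : ∀ f g : F[X], f.Monic → g.Monic → Λ (f * g) = Λ f * Λ g) (m : ℕ) :
    (m : R) * ∑ f ∈ monicsOfDegree F m, Λ f =
      ∑ k ∈ Finset.Icc 1 m, primePowerSum Λ k * ∑ f ∈ monicsOfDegree F (m - k), Λ f := by
  classical
  have hpow : ∀ (P : F[X]) (r : ℕ), P.Monic → Λ (P ^ r) = Λ P ^ r := by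
    intro P r hP
    induction r with
    | zero => simp [hone]
    | succ r ih => rw [pow_succ, hmul _ _ (hP.pow r) hP, ih, pow_succ]
  -- Write m as the sum of deg P over all pairs (P, r) with r ≥ 1 and P^r dividing f, and index by k
  -- = r·deg P.
  have h1 : ∀ f ∈ monicsOfDegree F m, (m : R) * Λ f =
      ∑ k ∈ Finset.Icc 1 m, ∑ P ∈ monicIrreducibles F m,
        if P.natDegree ∣ k then
          (P.natDegree : R) * (if P ^ (k / P.natDegree) ∣ f then Λ f else 0) else 0 := by
    intro f hf
    rw [Finset.sum_comm]
    conv_lhs => rw [natDegree_eq_sum_multiplicity hf]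
    rw [Nat.cast_sum, Finset.sum_mul]
    refine Finset.sum_congr rfl fun P hP => ?_
    rw [multiplicity_eq_card_filter hf hP, Finset.card_filter]
    push_cast
    rw [Finset.sum_mul, Finset.sum_mul]
    refine Finset.sum_congr rfl fun k _ => ?_
    by_cases h2 : P.natDegree ∣ k <;> by_cases h3 : P ^ (k / P.natDegree) ∣ f <;> simp [h2, h3]
  rw [Finset.mul_sum, Finset.sum_congr rfl h1, Finset.sum_comm]
  refine Finset.sum_congr rfl fun k hk => ?_
  rw [Finset.mem_Icc] at hk
  rw [Finset.sum_comm, primePowerSum_eq Λ hk.1 hk.2, Finset.sum_mul]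
  refine Finset.sum_congr rfl fun P hP => ?_
  obtain ⟨hPm, hPi, -⟩ := mem_monicIrreducibles.mp hP
  by_cases hd : P.natDegree ∣ k
  · have hdeg : (P ^ (k / P.natDegree)).natDegree = k := by
      rw [natDegree_pow, Nat.div_mul_cancel hd]
    have := sum_monicsOfDegree_filter_dvd hmul (hPm.pow (k / P.natDegree)) (m := m)
      (by rw [hdeg]; exact hk.2)
    simp only [hd, if_true]
    rw [← Finset.mul_sum, ← Finset.sum_filter, this, hdeg, hpow _ _ hPm, mul_assoc]
  · simp [hd]

/-- The prime power sum of degree `k`, as a sum over the extension of degree `k`. -/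
theorem sum_minpoly_eq_primePowerSum (Λ : F[X] → R) (K : Type*) [Field K] [Fintype K]
    [Algebra F K] : ∑ x : K, Λ (minpoly F x) ^ (Module.finrank F K / (minpoly F x).natDegree) =
      primePowerSum Λ (Module.finrank F K) := by
  classical
  set k := Module.finrank F K with hk
  have : Fintype F := Fintype.ofFinite F
  have hkpos : 0 < k := Module.finrank_pos
  have hinteg : ∀ x : K, IsIntegral F x := fun x => .of_finite F x
  have hmem : ∀ x ∈ (Finset.univ : Finset K),
      minpoly F x ∈ (monicIrreducibles F k).filter (·.natDegree ∣ k) := by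
    intro x _
    have hd : (minpoly F x).natDegree ∣ k := minpoly.degree_dvd (hinteg x)
    simp only [Finset.mem_filter, mem_monicIrreducibles]
    exact ⟨⟨minpoly.monic (hinteg x), minpoly.irreducible (hinteg x), Nat.le_of_dvd hkpos hd⟩, hd⟩
  rw [← Finset.sum_fiberwise_of_maps_to hmem, primePowerSum]
  refine Finset.sum_congr rfl fun P hP => ?_
  simp only [Finset.mem_filter, mem_monicIrreducibles] at hP
  obtain ⟨⟨hPm, hPi, -⟩, hPd⟩ := hP
  have hfiber : (Finset.univ.filter fun x : K => minpoly F x = P) = (P.rootSet K).toFinset := by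
    ext x
    simp only [Finset.mem_filter, Finset.mem_univ, true_and, Set.mem_toFinset,
      mem_rootSet_of_ne hPm.ne_zero]
    constructor
    · rintro rfl; exact minpoly.aeval F x
    · intro h; exact (minpoly.eq_of_irreducible_of_monic hPi h hPm).symm
  -- An irreducible polynomial of degree dividing k divides X^|K| - X. It therefore splits in K and,
  -- being separable, is the minimal polynomial of exactly deg P elements.
  have hsplit : (P.map (algebraMap F K)).Splits := by
    have hdvd := hPi.natDegree_dvd_iff_dvd_X_pow_card_pow_sub_X.mp hPd
    have hc : Nat.card F ^ k = Fintype.card K := by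
      rw [hk, ← Module.natCard_eq_pow_finrank, Nat.card_eq_fintype_card]
    rw [hc] at hdvd
    have := (FiniteField.isSplittingField_sub K F).splits'
    refine Splits.of_dvd this ?_ (Polynomial.map_dvd (algebraMap F K) hdvd)
    exact Polynomial.map_ne_zero (FiniteField.X_pow_card_sub_X_ne_zero F Fintype.one_lt_card)
  have hcard : (Finset.univ.filter fun x : K => minpoly F x = P).card = P.natDegree := by
    rw [hfiber, Set.toFinset_card, card_rootSet_eq_natDegree
      (PerfectField.separable_of_irreducible hPi) hsplit]
  rw [Finset.sum_congr rfl (g := fun _ => Λ P ^ (k / P.natDegree)), Finset.sum_const, hcard,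
    nsmul_eq_mul]
  intro x hx
  rw [(Finset.mem_filter.mp hx).2]

end MonicPolynomials

/-! ### The L-function of a Kloosterman sum is quadratic. -/

section SmallDegree

variable {F : Type*} [Field F] [Fintype F] {R : Type*} [CommRing R]

theorem sum_monicsOfDegree_zero (Λ : F[X] → R) : ∑ f ∈ monicsOfDegree F 0, Λ f = Λ 1 := by
  have : monicsOfDegree F 0 = {1} := by
    ext f
    simp only [mem_monicsOfDegree, Finset.mem_singleton]
    exact ⟨fun h => h.1.natDegree_eq_zero.mp h.2, fun h => by simp [h]⟩
  rw [this, Finset.sum_singleton]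

theorem sum_monicsOfDegree_one (Λ : F[X] → R) :
    ∑ f ∈ monicsOfDegree F 1, Λ f = ∑ x : F, Λ (X - C x) := by
  symm
  refine Finset.sum_bij (fun x _ => X - C x) ?_ ?_ ?_ ?_
  · intro x _; simp [monic_X_sub_C]
  · intro x _ y _ h; simpa using h
  · intro f hf
    obtain ⟨h1, h2⟩ := mem_monicsOfDegree.mp hf
    refine ⟨-f.coeff 0, Finset.mem_univ _, ?_⟩
    rw [map_neg, sub_neg_eq_add, ← h1.eq_X_add_C h2]
  · intro _ _; rfl

theorem sum_monicsOfDegree_two (Λ : F[X] → R) : ∑ f ∈ monicsOfDegree F 2, Λ f =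
    ∑ c : F, ∑ b : F, Λ (X ^ 2 + C b * X + C c) := by
  rw [← Fintype.sum_prod_type']
  symm
  have hd : ∀ b c : F, (X ^ 2 + C b * X + C c).natDegree = 2 := fun b c => by compute_degree!
  refine Finset.sum_bij (fun x _ => X ^ 2 + C x.2 * X + C x.1) ?_ ?_ ?_ ?_
  · intro x _
    rw [mem_monicsOfDegree, Monic, leadingCoeff, hd]
    exact ⟨by simp, rfl⟩
  · rintro ⟨c, b⟩ _ ⟨c', b'⟩ _ h
    have h0 := congrArg (coeff · 0) h
    have h1 := congrArg (coeff · 1) h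
    simp only [coeff_add, coeff_X_pow, coeff_C_mul, coeff_X, coeff_C] at h0 h1
    simp at h0 h1
    rw [h0, h1]
  · intro f hf
    obtain ⟨h1, h2⟩ := mem_monicsOfDegree.mp hf
    refine ⟨(f.coeff 0, f.coeff 1), Finset.mem_univ _, ?_⟩
    conv_rhs => rw [f.as_sum_range_C_mul_X_pow, h2]
    have h3 : f.coeff 2 = 1 := by rw [← h2]; exact h1
    simp [Finset.sum_range_succ, h3]
    ring
  · intro _ _; rfl

end SmallDegree

section KloostermanCharacter

variable {F : Type*} [Field F] [DecidableEq F] {R : Type*} [CommRing R]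

/-- The completely multiplicative function on monic polynomials whose `L`-function is that of the
Kloosterman sum: `f ↦ ψ(∑ (x + α / x))`, the sum over the roots `x` of `f`. -/
noncomputable def kloostermanCharacter (ψ : AddChar F R) (α : Fˣ) (f : F[X]) : R :=
  if f.coeff 0 = 0 then 0 else ψ (-f.nextCoeff - α * (f.coeff 1 / f.coeff 0))

theorem kloostermanCharacter_one (ψ : AddChar F R) (α : Fˣ) : kloostermanCharacter ψ α 1 = 1 := by
  simp [kloostermanCharacter, nextCoeff, coeff_one]

theorem kloostermanCharacter_mul (ψ : AddChar F R) (α : Fˣ) (f g : F[X]) (hf : f.Monic)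
    (hg : g.Monic) : kloostermanCharacter ψ α (f * g) =
      kloostermanCharacter ψ α f * kloostermanCharacter ψ α g := by
  simp only [kloostermanCharacter, mul_coeff_zero, mul_coeff_one, hf.nextCoeff_mul hg]
  by_cases h1 : f.coeff 0 = 0
  · simp [h1]
  by_cases h2 : g.coeff 0 = 0
  · simp [h2]
  simp only [h1, h2, mul_eq_zero, or_self, if_false, ← AddChar.map_add_eq_mul]
  congr 1
  field_simp
  ring

variable [Fintype F]

/-- The linear coefficient of the L-function. The factor X contributes nothing, and the sign undoes
the one in `kloostermanSum`. -/
theorem sum_kloostermanCharacter_one (ψ : AddChar F R) (α : Fˣ) :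
    ∑ f ∈ monicsOfDegree F 1, kloostermanCharacter ψ α f = -kloostermanSum ψ α := by
  rw [sum_monicsOfDegree_one, kloostermanSum, neg_neg]
  have h0 : kloostermanCharacter ψ α (X - C 0) = 0 := by simp [kloostermanCharacter]
  rw [← Finset.add_sum_erase _ _ (Finset.mem_univ (0 : F)), h0, zero_add]
  symm
  refine Finset.sum_bij (fun x _ => (x : F)) ?_ ?_ ?_ ?_
  · intro x _; simp
  · intro x _ y _ h; exact Units.ext h
  · intro x hx
    exact ⟨Units.mk0 x (Finset.ne_of_mem_erase hx), Finset.mem_univ _, rfl⟩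
  · intro x _
    have : (X - C (x : F)).coeff 0 ≠ 0 := by simp
    rw [kloostermanCharacter, if_neg this, nextCoeff_X_sub_C]
    congr 1
    have hx := x.ne_zero
    simp [coeff_X]
    field_simp

/-- For X² + bX + c with c ≠ 0 the value is ψ(-b(1 + α/c)); orthogonality in b leaves only c = -α,
where all q values are 1. -/
theorem sum_kloostermanCharacter_two [IsDomain R] (ψ : AddChar F R) (hψ : ψ ≠ 1) (α : Fˣ) :
    ∑ f ∈ monicsOfDegree F 2, kloostermanCharacter ψ α f = Fintype.card F := by
  rw [sum_monicsOfDegree_two]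
  have hprim : ψ.IsPrimitive := AddChar.IsPrimitive.of_ne_one hψ
  have h1 : ∀ c : F, ∑ b : F, kloostermanCharacter ψ α (X ^ 2 + C b * X + C c) =
      if c = -α then (Fintype.card F : R) else 0 := by
    intro c
    have hd : ∀ b c : F, (X ^ 2 + C b * X + C c).natDegree = 2 := fun b c => by compute_degree!
    have hval : ∀ b, kloostermanCharacter ψ α (X ^ 2 + C b * X + C c) =
        if c = 0 then 0 else ψ (b * (-(1 + α / c))) := by
      intro b
      simp only [kloostermanCharacter, nextCoeff, hd]
      simp [coeff_X, coeff_C, coeff_X_pow]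
      split_ifs with h
      · rfl
      · congr 1; ring
    simp only [hval]
    by_cases hc : c = 0
    · have : c ≠ -α := fun h => α.ne_zero (by rw [hc] at h; simpa using h.symm)
      simp [hc] at this ⊢
    · simp only [hc, if_false]
      rw [AddChar.sum_mulShift _ hprim]
      have : -(1 + (α : F) / c) = 0 ↔ c = -α := by
        rw [neg_eq_zero, ← mul_left_inj' hc, add_mul, div_mul_cancel₀ _ hc, one_mul, zero_mul,
          add_eq_zero_iff_eq_neg]
      simp only [this]
      split_ifs <;> simp
  simp [h1]

/-- From degree 3 on, the second-highest coefficient is distinct from the two lowest. Shifting it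
permutes the polynomials and multiplies the sum by a value ψ(c) ≠ 1. -/
theorem sum_kloostermanCharacter_of_three_le [IsDomain R] (ψ : AddChar F R) (hψ : ψ ≠ 1) (α : Fˣ)
    {m : ℕ} (hm : 3 ≤ m) : ∑ f ∈ monicsOfDegree F m, kloostermanCharacter ψ α f = 0 := by
  obtain ⟨c, hc⟩ := AddChar.ne_one_iff.mp hψ
  set A := ∑ f ∈ monicsOfDegree F m, kloostermanCharacter ψ α f with hA
  have hdeg : ∀ (f : F[X]) (c : F), f ∈ monicsOfDegree F m →
      f + C c * X ^ (m - 1) ∈ monicsOfDegree F m := by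
    intro f c hf
    obtain ⟨h1, h2⟩ := mem_monicsOfDegree.mp hf
    have hlt : (C c * X ^ (m - 1)).degree < f.degree := by
      refine lt_of_le_of_lt (degree_C_mul_X_pow_le _ _) ?_
      rw [degree_eq_natDegree h1.ne_zero, h2]
      exact_mod_cast (by omega : m - 1 < m)
    exact mem_monicsOfDegree.mpr ⟨h1.add_of_left hlt,
      (natDegree_add_eq_left_of_degree_lt hlt).trans h2⟩
  have hshift : A = ψ c * A := by
    rw [hA, Finset.mul_sum]
    symm
    refine Finset.sum_bij (fun f _ => f + C (-c) * X ^ (m - 1)) (fun f hf => hdeg f _ hf) ?_ ?_ ?_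
    · intro f _ g _ h; simpa using h
    · intro f hf
      exact ⟨f + C c * X ^ (m - 1), hdeg f _ hf, by simp⟩
    · intro f hf
      have h1 := (mem_monicsOfDegree.mp (hdeg f (-c) hf)).2
      have h2 := (mem_monicsOfDegree.mp hf).2
      simp only [kloostermanCharacter, nextCoeff, h1, h2]
      have h0 : ¬ (m = 0) := by omega
      have h3 : ¬ (0 = m - 1) := by omega
      have h4 : ¬ (1 = m - 1) := by omega
      simp only [coeff_add, coeff_C_mul, coeff_X_pow, h0, h3, h4, if_false, if_true, mul_zero,
        add_zero, mul_one]
      split_ifs with h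
      · simp
      · rw [← AddChar.map_add_eq_mul]
        congr 1
        ring
  have h5 : (1 - ψ c) * A = 0 := by linear_combination hshift
  exact (mul_eq_zero.mp h5).resolve_left (sub_ne_zero.mpr (Ne.symm hc))

/-- The power sums of the two roots of the `L`-function of a Kloosterman sum. -/
theorem primePowerSum_kloostermanCharacter [IsDomain R] (ψ : AddChar F R) (hψ : ψ ≠ 1) (α : Fˣ)
    {u v : R} (hadd : u + v = kloostermanSum ψ α) (hmul : u * v = Fintype.card F) (m : ℕ) :
    primePowerSum (kloostermanCharacter ψ α) (m + 1) = -(u ^ (m + 1) + v ^ (m + 1)) := by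
  have hrec := natCast_mul_sum_monicsOfDegree (kloostermanCharacter_one ψ α)
    (kloostermanCharacter_mul ψ α)
  have h0 : ∑ f ∈ monicsOfDegree F 0, kloostermanCharacter ψ α f = 1 := by
    rw [sum_monicsOfDegree_zero, kloostermanCharacter_one]
  have h1 := sum_kloostermanCharacter_one ψ α
  have h2 := sum_kloostermanCharacter_two ψ hψ α
  rw [← hadd] at h1
  rw [← hmul] at h2
  induction m using Nat.strong_induction_on with
  | _ m ih =>
    match m, ih with
    | 0, _ =>
      have := hrec 1
      simp [h0, h1] at this
      simp only [zero_add, pow_one]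
      rw [← this]; ring
    | 1, ih =>
      have h3 := ih 0 one_pos
      have := hrec 2
      rw [Finset.sum_Icc_succ_top (by norm_num), Finset.sum_Icc_succ_top (by norm_num)] at this
      simp only [zero_add, Nat.reduceAdd, Nat.reduceSub, h0, h1, h2, Finset.Icc_eq_empty_of_lt,
        zero_lt_one, Finset.sum_empty, mul_one] at this h3
      push_cast at this
      rw [h3] at this
      linear_combination -this
    | n + 2, ih =>
      have h3 := ih n (by omega)
      have h4 := ih (n + 1) (by omega)
      have := hrec (n + 3)
      -- Only the last three values of k survive, which leaves Newton's recursion for the power sums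
      -- of u and v.
      rw [sum_kloostermanCharacter_of_three_le ψ hψ α (by omega), mul_zero,
        Finset.sum_Icc_succ_top (by omega), Finset.sum_Icc_succ_top (by omega),
        Finset.sum_Icc_succ_top (by omega), Finset.sum_eq_zero, zero_add, Nat.sub_self,
        show n + 3 - (n + 1) = 2 by omega, show n + 3 - (n + 1 + 1) = 1 by omega,
        h0, h1, h2, h3, h4] at this
      · show primePowerSum _ (n + 1 + 1 + 1) = _
        linear_combination -this
      · intro k hk
        rw [Finset.mem_Icc] at hk
        rw [sum_kloostermanCharacter_of_three_le ψ hψ α (by omega), mul_zero]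

end KloostermanCharacter

/-! ### Kloosterman sums over extensions as prime power sums. -/

section Trace

variable {F K : Type*} [Field F] [Field K] [Algebra F K] [FiniteDimensional F K]

theorem minpoly_coeff_zero_ne_zero {x : K} (hx : x ≠ 0) : (minpoly F x).coeff 0 ≠ 0 :=
  minpoly.coeff_zero_ne_zero (.of_finite F x) hx

/-- The minimal polynomial of an inverse is, up to a constant, the reversed polynomial. -/
theorem minpoly_inv {x : K} (hx : x ≠ 0) :
    minpoly F x⁻¹ = C ((minpoly F x).coeff 0)⁻¹ * (minpoly F x).reverse := by
  have h0 := minpoly_coeff_zero_ne_zero (F := F) hx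
  have hinteg : IsIntegral F x := .of_finite F x
  have hdeg : (minpoly F x).reverse.natDegree = (minpoly F x).natDegree := by
    rw [reverse_natDegree, natTrailingDegree_eq_zero.mpr (Or.inr h0), Nat.sub_zero]
  have hfin : (minpoly F x⁻¹).natDegree = (minpoly F x).natDegree := by
    have hadj : IntermediateField.adjoin F {x⁻¹} = IntermediateField.adjoin F {x} := by
      apply le_antisymm <;> rw [IntermediateField.adjoin_simple_le_iff]
      · exact inv_mem (IntermediateField.mem_adjoin_simple_self F x)
      · simpa using inv_mem (IntermediateField.mem_adjoin_simple_self F x⁻¹)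
    rw [← IntermediateField.adjoin.finrank hinteg,
      ← IntermediateField.adjoin.finrank (.of_finite F x⁻¹), hadj]
  have haeval : aeval x⁻¹ (minpoly F x).reverse = 0 := by
    let : Invertible x := invertibleOfNonzero hx
    have := (eval₂_reverse_eq_zero_iff (algebraMap F K) x (minpoly F x)).mpr (minpoly.aeval F x)
    rwa [invOf_eq_inv] at this
  have hmonic : (C ((minpoly F x).coeff 0)⁻¹ * (minpoly F x).reverse).Monic := by
    rw [Monic, leadingCoeff_mul, leadingCoeff_C, reverse_leadingCoeff, trailingCoeff,
      natTrailingDegree_eq_zero.mpr (Or.inr h0), inv_mul_cancel₀ h0]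
  refine eq_of_monic_of_dvd_of_natDegree_le (minpoly.monic (.of_finite F x⁻¹)) hmonic
    (minpoly.dvd F _ (by rw [map_mul, haeval, mul_zero])) ?_ |>.symm
  rw [natDegree_C_mul (inv_ne_zero h0), hdeg, hfin]

theorem nextCoeff_minpoly_inv {x : K} (hx : x ≠ 0) :
    (minpoly F x⁻¹).nextCoeff = (minpoly F x).coeff 1 / (minpoly F x).coeff 0 := by
  have h0 := minpoly_coeff_zero_ne_zero (F := F) hx
  have hpos : 0 < (minpoly F x).natDegree := minpoly.natDegree_pos (.of_finite F x)
  have hdeg : (minpoly F x).reverse.natDegree = (minpoly F x).natDegree := by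
    rw [reverse_natDegree, natTrailingDegree_eq_zero.mpr (Or.inr h0), Nat.sub_zero]
  rw [minpoly_inv hx, nextCoeff, natDegree_C_mul (inv_ne_zero h0), hdeg, if_neg hpos.ne',
    coeff_C_mul, coeff_reverse, revAt_le (by omega), Nat.sub_sub_self hpos, inv_mul_eq_div]

theorem finrank_div_natDegree_minpoly (x : K) :
    Module.finrank F K / (minpoly F x).natDegree =
      Module.finrank (IntermediateField.adjoin F {x}) K := by
  rw [← IntermediateField.adjoin.finrank (.of_finite F x : IsIntegral F x),
    ← Module.finrank_mul_finrank F (IntermediateField.adjoin F {x}) K]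
  exact Nat.mul_div_cancel_left _ Module.finrank_pos

variable {R : Type*} [CommRing R] [DecidableEq F]

/-- The trace of x is -[K : F(x)] times the next coefficient of its minimal polynomial. The same
factor serves for x⁻¹, whose minimal polynomial has the same degree, and the exponent on the left is
exactly this factor. -/
theorem kloostermanCharacter_minpoly_pow (ψ : AddChar F R) (α : Fˣ) {x : K} (hx : x ≠ 0) :
    kloostermanCharacter ψ α (minpoly F x) ^ (Module.finrank F K / (minpoly F x).natDegree) =
      ψ (Algebra.trace F K (x + algebraMap F K α / x)) := by
  have h1 : Module.finrank (IntermediateField.adjoin F {x⁻¹}) K =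
      Module.finrank (IntermediateField.adjoin F {x}) K := by
    rw [← finrank_div_natDegree_minpoly, ← finrank_div_natDegree_minpoly, minpoly_inv hx,
      natDegree_C_mul (inv_ne_zero (minpoly_coeff_zero_ne_zero hx)), reverse_natDegree,
      natTrailingDegree_eq_zero.mpr (Or.inr (minpoly_coeff_zero_ne_zero hx)), Nat.sub_zero]
  rw [kloostermanCharacter, if_neg (minpoly_coeff_zero_ne_zero hx), ← AddChar.map_nsmul_eq_pow,
    div_eq_mul_inv (algebraMap F K α) x, ← Algebra.smul_def, map_add, LinearMap.map_smul,
    trace_eq_finrank_mul_minpoly_nextCoeff, trace_eq_finrank_mul_minpoly_nextCoeff,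
    nextCoeff_minpoly_inv hx, finrank_div_natDegree_minpoly, h1, nsmul_eq_mul, smul_eq_mul]
  congr 1
  ring

theorem sum_kloosterman_extension [Fintype F] [Fintype K] [DecidableEq K] (ψ : AddChar F R)
    (α : Fˣ) (β : Kˣ) (hβ : (β : K) = algebraMap F K α) :
    ∑ x : Kˣ, ψ (Algebra.trace F K ((x : K) + (β : K) / (x : K))) =
      primePowerSum (kloostermanCharacter ψ α) (Module.finrank F K) := by
  rw [← sum_minpoly_eq_primePowerSum]
  rw [← Finset.add_sum_erase _ _ (Finset.mem_univ (0 : K))]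
  have h0 : kloostermanCharacter ψ α (minpoly F (0 : K)) ^
      (Module.finrank F K / (minpoly F (0 : K)).natDegree) = 0 := by
    rw [minpoly.zero, natDegree_X, Nat.div_one, kloostermanCharacter, if_pos coeff_X_zero,
      zero_pow Module.finrank_pos.ne']
  rw [h0, zero_add]
  refine Finset.sum_bij (fun x _ => (x : K)) ?_ ?_ ?_ ?_
  · intro x _; simp
  · intro x _ y _ h; exact Units.ext h
  · intro x hx
    exact ⟨Units.mk0 x (Finset.ne_of_mem_erase hx), Finset.mem_univ _, rfl⟩
  · intro x _
    rw [kloostermanCharacter_minpoly_pow ψ α x.ne_zero, hβ]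

end Trace

/-! ### Weil's bound from growth along even extensions. -/

section WeilBound

variable {F : Type*} [Field F] [Fintype F] [DecidableEq F]

theorem conj_kloostermanSum (ψ : AddChar F ℂ) (α : Fˣ) :
    (starRingEnd ℂ) (kloostermanSum ψ α) = kloostermanSum ψ α := by
  rw [kloostermanSum, map_neg, map_sum]
  congr 1
  refine Fintype.sum_equiv (Equiv.neg Fˣ) _ _ fun x => ?_
  rw [← AddChar.map_neg_eq_conj]
  congr 1
  simp only [Equiv.neg_apply, Units.val_neg]
  ring

/-- The crude bound for the power sums of even degree of the roots of the `L`-function. -/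
theorem norm_primePowerSum_kloostermanCharacter_le {p : ℕ} [Fact p.Prime] [CharP F p]
    (hp3 : 3 ≤ p) (ψ : AddChar F ℂ) (hψ : ψ ≠ 1) (α : Fˣ) {s : ℕ} (hs : 2 ≤ s) :
    ‖primePowerSum (kloostermanCharacter ψ α) (2 * s)‖ ≤
      2 * Fintype.card F * (Fintype.card F : ℝ) ^ s + 1 := by
  classical
  have hp : p.Prime := Fact.out
  have : NeZero (2 * s) := ⟨by omega⟩
  let K := FiniteField.Extension F p (2 * s)
  let : Fintype K := Fintype.ofFinite K
  have : CharP K p := charP_of_injective_algebraMap (algebraMap F K).injective p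
  obtain ⟨f, hf, hq⟩ := FiniteField.card F p
  set q := Fintype.card F with hqdef
  have hcard : Fintype.card K = (p ^ (f * s : ℕ)) ^ 2 := by
    rw [← Nat.card_eq_fintype_card, FiniteField.natCard_extension, Nat.card_eq_fintype_card,
      ← hqdef, hq, ← pow_mul, ← pow_mul]
    congr 1; ring
  have hqs : p ^ (f * s : ℕ) = q ^ s := by rw [hq, ← pow_mul]
  have hodd : Odd p := hp.odd_of_ne_two (by omega)
  obtain ⟨a, ha⟩ : Odd (p ^ (f * s : ℕ)) := hodd.pow
  have hq3 : 3 ≤ q := by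
    rw [hq]; exact hp3.trans (Nat.le_self_pow f.ne_zero p)
  -- Here s ≥ 2 matters: 2a + 1 = q^s ≥ q² ≥ 3q.
  have hqa : q ≤ a := by
    have h1 : q ^ 2 ≤ q ^ s := Nat.pow_le_pow_right (by omega) hs
    rw [← hqs, ha] at h1
    nlinarith
  have h2 : (2 : K) ≠ 0 := by
    intro h
    have h' : ((2 : ℕ) : K) = 0 := by exact_mod_cast h
    rw [CharP.cast_eq_zero_iff K p] at h'
    have := Nat.le_of_dvd two_pos h'
    omega
  let β : Kˣ := Units.map (algebraMap F K : F →* K) α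
  let Ψ : AddChar K ℂ := ψ.compAddMonoidHom (Algebra.trace F K : K →ₗ[F] F).toAddMonoidHom
  have hΨ : Ψ ≠ 1 := by
    obtain ⟨c, hc⟩ := AddChar.ne_one_iff.mp hψ
    obtain ⟨y, hy⟩ := Algebra.trace_surjective F K c
    exact AddChar.ne_one_iff.mpr ⟨y, by simpa [Ψ, hy] using hc⟩
  -- The q-power map is an F-automorphism of K, so it preserves the trace.
  have hΨq : ∀ y, Ψ (y ^ q - y) = 1 := by
    intro y
    have : Algebra.trace F K (y ^ q) = Algebra.trace F K y := by
      rw [← Algebra.trace_eq_of_algEquiv (FiniteField.Extension.frob F p (2 * s)) y,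
        FiniteField.Extension.frob_apply, Nat.card_eq_fintype_card]
    simp [Ψ, this]
  have hmain := norm_sum_kloosterman_le hcard ha (by omega) hqa h2 β Ψ hΨ hΨq
  have hsum := sum_kloosterman_extension (K := K) ψ α β rfl
  rw [FiniteField.finrank_extension] at hsum
  rw [← hsum]
  refine hmain.trans (le_of_eq ?_)
  have : ((p : ℝ) ^ (f * s : ℕ)) = (q : ℝ) ^ s := by exact_mod_cast hqs
  rw [this]

/-- Weil's bound for Kloosterman sums. -/
theorem abs_re_kloostermanSum_le {p : ℕ} [Fact p.Prime] [CharP F p] (hp3 : 3 ≤ p)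
    (ψ : AddChar F ℂ) (hψ : ψ ≠ 1) (α : Fˣ) :
    |(kloostermanSum ψ α).re| ≤ 2 * √(Fintype.card F : ℝ) := by
  set q : ℝ := (Fintype.card F : ℝ) with hq
  have hq1 : 1 < q := by
    rw [hq]; exact_mod_cast Fintype.one_lt_card
  set r := (kloostermanSum ψ α).re with hr
  have hreal : kloostermanSum ψ α = (r : ℂ) := (Complex.conj_eq_iff_re.mp
    (conj_kloostermanSum ψ α)).symm
  by_contra! hlt
  have hr2 : 4 * q < r ^ 2 := by
    rw [← sq_abs r]
    have h1 := pow_lt_pow_left₀ hlt (by positivity) two_ne_zero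
    rw [mul_pow, Real.sq_sqrt (by linarith)] at h1
    linarith
  set w := √(r ^ 2 - 4 * q) with hw
  have hw2 : w ^ 2 = r ^ 2 - 4 * q := Real.sq_sqrt (by linarith)
  set u := (r + w) / 2 with hu
  set v := (r - w) / 2 with hv
  have huv : u * v = q := by rw [hu, hv]; linarith
  have hadd : u + v = r := by rw [hu, hv]; ring
  have hbound : ∀ s, 2 ≤ s → (u ^ 2) ^ s + (v ^ 2) ^ s ≤ 2 * q * q ^ s + 1 := by
    intro s hs
    have h1 := norm_primePowerSum_kloostermanCharacter_le hp3 ψ hψ α hs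
    have h2 := primePowerSum_kloostermanCharacter ψ hψ α (u := (u : ℂ)) (v := (v : ℂ))
      (by rw [hreal, ← hadd]; push_cast; rfl) (by exact_mod_cast huv) (2 * s - 1)
    rw [show 2 * s - 1 + 1 = 2 * s by omega] at h2
    rw [h2, norm_neg, pow_mul, pow_mul] at h1
    have h3 : ((u : ℂ) ^ 2) ^ s + ((v : ℂ) ^ 2) ^ s = (((u ^ 2) ^ s + (v ^ 2) ^ s : ℝ) : ℂ) := by
      push_cast; rfl
    rw [h3, Complex.norm_real, Real.norm_of_nonneg (by positivity)] at h1
    exact h1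
  -- Since u² + v² = r² - 2q > 2q, one of the squares exceeds q. Its powers outgrow any constant
  -- multiple of q^s.
  obtain ⟨t, ht, htb⟩ : ∃ t, q < t ∧ ∀ s, 2 ≤ s → t ^ s ≤ 2 * q * q ^ s + 1 := by
    have h1 : 2 * q < u ^ 2 + v ^ 2 := by
      have : u ^ 2 + v ^ 2 = r ^ 2 - 2 * q := by rw [← hadd, ← huv]; ring
      linarith
    rcases lt_or_ge q (u ^ 2) with h2 | h2
    · exact ⟨_, h2, fun s hs => by
        have := hbound s hs
        have : 0 ≤ (v ^ 2) ^ s := by positivity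
        linarith⟩
    · exact ⟨v ^ 2, by linarith, fun s hs => by
        have := hbound s hs
        have : 0 ≤ (u ^ 2) ^ s := by positivity
        linarith⟩
  have hq0 : 0 < q := by linarith
  obtain ⟨n, hn⟩ := pow_unbounded_of_one_lt (2 * q + 1) ((one_lt_div hq0).mpr ht)
  have h1 := htb (n + 2) (by omega)
  have h2 : 2 * q + 1 < (t / q) ^ (n + 2) :=
    hn.trans_le (pow_le_pow_right₀ ((one_lt_div hq0).mpr ht).le (by omega))
  rw [div_pow, lt_div_iff₀ (by positivity)] at h2
  have h3 : 1 ≤ q ^ (n + 2) := one_le_pow₀ hq1.le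
  linarith

end WeilBound

/-! ### A Liouville inequality and fields generated by roots of unity. -/

section Liouville

/-- A nonzero algebraic integer in a number field of degree at most `D`, all of whose conjugates
are bounded by `B`, is not too small. -/
theorem one_le_norm_mul_pow_of_isIntegral {η : AlgebraicClosure ℚ} (hinteg : IsIntegral ℤ η)
    (hne : η ≠ 0) (K : IntermediateField ℚ (AlgebraicClosure ℚ)) [FiniteDimensional ℚ K]
    (hK : η ∈ K) {B : ℝ} (hB : 1 ≤ B) {D : ℕ} (hD : Module.finrank ℚ K ≤ D)
    (hbd : ∀ ι : AlgebraicClosure ℚ →+* ℂ, ‖ι η‖ ≤ B) (ι : AlgebraicClosure ℚ →+* ℂ) :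
    1 ≤ ‖ι η‖ * B ^ (D - 1) := by
  classical
  set x : K := ⟨η, hK⟩ with hx
  have hx0 : x ≠ 0 := fun h => hne (congrArg Subtype.val h)
  have hxint : IsIntegral ℤ x :=
    (isIntegral_algHom_iff (K.val.restrictScalars ℤ) K.val.injective).mp hinteg
  obtain ⟨a, ha⟩ := IsIntegrallyClosed.isIntegral_iff.mp (Algebra.isIntegral_norm ℚ hxint)
  have ha0 : a ≠ 0 := by
    rintro rfl
    rw [map_zero] at ha
    exact hx0 (Algebra.norm_eq_zero_iff.mp ha.symm)
  have hprod : ((a : ℤ) : ℂ) = ∏ σ : K →ₐ[ℚ] ℂ, σ x := by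
    rw [← Algebra.norm_eq_prod_embeddings ℚ ℂ x, ← ha]
    simp
  -- Each embedding of K extends to the algebraic closure, so the bound assumed for embeddings of
  -- the closure applies.
  have hext : ∀ σ : K →ₐ[ℚ] ℂ, ‖σ x‖ ≤ B := by
    intro σ
    let := σ.toRingHom.toAlgebra
    have : Algebra.IsAlgebraic ℚ (AlgebraicClosure ℚ) := AlgebraicClosure.isAlgebraic ℚ
    have := Algebra.IsAlgebraic.tower_top (K := ℚ) (A := AlgebraicClosure ℚ) K
    let τ : AlgebraicClosure ℚ →ₐ[K] ℂ := IsAlgClosed.lift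
    have h1 : τ η = σ x := τ.commutes x
    rw [← h1]
    exact hbd τ.toRingHom
  let σ₀ : K →ₐ[ℚ] ℂ := (ι.comp K.val.toRingHom).toRatAlgHom
  have hσ₀ : σ₀ x = ι η := rfl
  have h1 : (1 : ℝ) ≤ ‖((a : ℤ) : ℂ)‖ := by
    rw [Complex.norm_intCast]
    exact_mod_cast Int.one_le_abs ha0
  rw [hprod, ← Finset.mul_prod_erase _ _ (Finset.mem_univ σ₀), norm_mul, hσ₀] at h1
  refine h1.trans (mul_le_mul_of_nonneg_left ?_ (norm_nonneg _))
  rw [norm_prod]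
  refine (Finset.prod_le_prod (fun σ _ => norm_nonneg _) fun σ _ => hext σ).trans ?_
  rw [Finset.prod_const]
  refine pow_le_pow_right₀ hB ?_
  rw [Finset.card_erase_of_mem (Finset.mem_univ _), Finset.card_univ, AlgHom.card]
  omega

theorem exists_intermediateField_rootsOfUnity (M : ℕ) (hM : M ≠ 0) :
    ∃ K : IntermediateField ℚ (AlgebraicClosure ℚ), FiniteDimensional ℚ K ∧
      Module.finrank ℚ K ≤ M ∧ ∀ z : AlgebraicClosure ℚ, z ^ M = 1 → z ∈ K := by
  have : NeZero M := ⟨hM⟩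
  have : NeZero (M : AlgebraicClosure ℚ) := ⟨Nat.cast_ne_zero.mpr hM⟩
  obtain ⟨ζ, hζ⟩ := IsAlgClosed.exists_root (cyclotomic M (AlgebraicClosure ℚ))
    (degree_cyclotomic_pos M _ (Nat.pos_of_ne_zero hM)).ne'
  rw [isRoot_cyclotomic_iff] at hζ
  have hinteg : IsIntegral ℚ ζ := (AlgebraicClosure.isAlgebraic ℚ).isAlgebraic ζ |>.isIntegral
  refine ⟨IntermediateField.adjoin ℚ {ζ}, IntermediateField.adjoin.finiteDimensional hinteg, ?_, ?_⟩
  · rw [IntermediateField.adjoin.finrank hinteg]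
    have hd : minpoly ℚ ζ ∣ X ^ M - 1 := minpoly.dvd _ _ (by simp [hζ.pow_eq_one])
    refine (natDegree_le_of_dvd hd (X_pow_sub_C_ne_zero (Nat.pos_of_ne_zero hM) 1)).trans ?_
    exact (natDegree_X_pow_sub_C (r := (1 : ℚ))).le
  · intro z hz
    obtain ⟨i, -, rfl⟩ := hζ.eq_pow_of_pow_eq_one hz
    exact pow_mem (IntermediateField.mem_adjoin_simple_self ℚ ζ) i

end Liouville

/-! ### Reduction of character sums modulo a place above p. -/

section Reduction

/-- Reduction of algebraic integers modulo a place above `p`. -/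
theorem exists_reduction (p : ℕ) [hp : Fact p.Prime] :
    ∃ (k : Type) (_ : Field k) (_ : integralClosure ℤ (AlgebraicClosure ℚ) →+* k), CharP k p := by
  have hmax : (Ideal.span {(p : ℤ)}).IsMaximal :=
    PrincipalIdealRing.isMaximal_of_irreducible (Nat.prime_iff_prime_int.mp hp.out).irreducible
  obtain ⟨Q, hQ, hQp⟩ := Ideal.exists_ideal_over_maximal_of_isIntegral
    (S := integralClosure ℤ (AlgebraicClosure ℚ)) (Ideal.span {(p : ℤ)}) (by
      rw [(RingHom.injective_iff_ker_eq_bot _).mp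
        (FaithfulSMul.algebraMap_injective ℤ (integralClosure ℤ (AlgebraicClosure ℚ)))]
      exact bot_le)
  refine ⟨integralClosure ℤ (AlgebraicClosure ℚ) ⧸ Q, Ideal.Quotient.field Q,
    Ideal.Quotient.mk Q, ?_⟩
  let := Ideal.Quotient.field Q
  rw [CharP.charP_iff_prime_eq_zero hp.out, ← map_natCast (Ideal.Quotient.mk Q),
    Ideal.Quotient.eq_zero_iff_mem]
  have h1 : (p : ℤ) ∈ Q.comap (algebraMap ℤ (integralClosure ℤ (AlgebraicClosure ℚ))) :=
    hQp ▸ Ideal.mem_span_singleton_self (p : ℤ)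
  simpa using h1

end Reduction

section ReductionGraph

variable {k : Type*} [Field k]

/-- The graph of a reduction map, as a subring of the product of the field of algebraic numbers
and the residue field. -/
noncomputable def reductionGraph (red : integralClosure ℤ (AlgebraicClosure ℚ) →+* k) :
    Subring (AlgebraicClosure ℚ × k) :=
  ((integralClosure ℤ (AlgebraicClosure ℚ)).val.toRingHom.prod red).range

variable {red : integralClosure ℤ (AlgebraicClosure ℚ) →+* k}

theorem mem_reductionGraph {z : AlgebraicClosure ℚ} {a : k} : (z, a) ∈ reductionGraph red ↔
    ∃ y : integralClosure ℤ (AlgebraicClosure ℚ), (y : AlgebraicClosure ℚ) = z ∧ red y = a := by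
  simp [reductionGraph, RingHom.mem_range, Prod.ext_iff]

theorem isIntegral_of_mem_reductionGraph {z : AlgebraicClosure ℚ} {a : k}
    (h : (z, a) ∈ reductionGraph red) : IsIntegral ℤ z := by
  obtain ⟨y, rfl, -⟩ := mem_reductionGraph.mp h
  exact y.2

/-- The residue of 0 is 0; in contrapositive form this certifies that an algebraic integer with
residue 1 is nonzero. -/
theorem eq_zero_of_mem_reductionGraph {a : k}
    (h : ((0 : AlgebraicClosure ℚ), a) ∈ reductionGraph red) : a = 0 := by
  obtain ⟨y, hy, rfl⟩ := mem_reductionGraph.mp h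
  rw [show y = 0 from Subtype.ext hy, map_zero]

theorem exists_mem_reductionGraph {z : AlgebraicClosure ℚ} (hz : IsIntegral ℤ z) :
    ∃ a, (z, a) ∈ reductionGraph red :=
  ⟨red ⟨z, hz⟩, mem_reductionGraph.mpr ⟨⟨z, hz⟩, rfl, rfl⟩⟩

theorem natCast_mem_reductionGraph (n : ℕ) :
    ((n : AlgebraicClosure ℚ), (n : k)) ∈ reductionGraph red :=
  natCast_mem (reductionGraph red) n

theorem sum_mem_reductionGraph {ι : Type*} (s : Finset ι) {f : ι → AlgebraicClosure ℚ} {g : ι → k}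
    (h : ∀ i ∈ s, (f i, g i) ∈ reductionGraph red) :
    (∑ i ∈ s, f i, ∑ i ∈ s, g i) ∈ reductionGraph red := by
  have h1 : ∑ i ∈ s, (f i, g i) = (∑ i ∈ s, f i, ∑ i ∈ s, g i) :=
    Prod.ext Prod.fst_sum Prod.snd_sum
  rw [← h1]
  exact sum_mem h

/-- In characteristic p the residue a satisfies (a - 1)^p = a^p - 1 = 0. -/
theorem mem_reductionGraph_of_pow_eq_one {p : ℕ} [Fact p.Prime] [CharP k p]
    {z : AlgebraicClosure ℚ} (hz : z ^ p = 1) : (z, 1) ∈ reductionGraph red := by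
  have hp : p.Prime := Fact.out
  have hinteg : IsIntegral ℤ z := IsIntegral.of_pow hp.pos (hz ▸ isIntegral_one)
  obtain ⟨y, hy⟩ : ∃ y : integralClosure ℤ (AlgebraicClosure ℚ), (y : AlgebraicClosure ℚ) = z :=
    ⟨⟨z, hinteg⟩, rfl⟩
  refine mem_reductionGraph.mpr ⟨y, hy, ?_⟩
  have h1 : y ^ p = 1 := Subtype.ext (by simp [hy, hz])
  have h2 : (red y - 1) ^ p = 0 := by
    rw [sub_pow_char, one_pow, ← map_pow, h1, map_one, sub_self]
  exact sub_eq_zero.mp (pow_eq_zero_iff hp.ne_zero |>.mp h2)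

theorem addChar_pow_char {F : Type*} [Field F] {p : ℕ} [CharP F p] {R : Type*} [CommRing R]
    (ψ : AddChar F R) (x : F) : ψ x ^ p = 1 := by
  rw [← AddChar.map_nsmul_eq_pow, nsmul_eq_mul, CharP.cast_eq_zero, zero_mul,
    AddChar.map_zero_eq_one]

variable {F : Type*} [Field F] [Fintype F] {p : ℕ} [CharP F p]

variable (F) in
theorem card_mem_reductionGraph [CharP k p] :
    ((Fintype.card F : AlgebraicClosure ℚ), (0 : k)) ∈ reductionGraph red := by
  have h : ((Fintype.card F : ℕ) : k) = 0 := by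
    rw [CharP.cast_eq_zero_iff k p, ← CharP.cast_eq_zero_iff F p, FiniteField.cast_card_eq_zero]
  rw [← h]
  exact natCast_mem_reductionGraph _

variable [Fact p.Prime]

theorem kloostermanSum_mem_reductionGraph [DecidableEq F] [CharP k p]
    (ψ : AddChar F (AlgebraicClosure ℚ)) (α : Fˣ) :
    (kloostermanSum ψ α, (1 : k)) ∈ reductionGraph red := by
  have h1 := neg_mem (sum_mem_reductionGraph (red := red) (Finset.univ : Finset Fˣ)
    (f := fun x => ψ ((x : F) + (α : F) / (x : F))) (g := fun _ => (1 : k))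
    fun x _ => mem_reductionGraph_of_pow_eq_one (addChar_pow_char (p := p) ψ _))
  have h2 : -∑ _x : Fˣ, (1 : k) = 1 := by
    have h3 : ((Fintype.card F : ℕ) : k) = 0 := by
      rw [CharP.cast_eq_zero_iff k p, ← CharP.cast_eq_zero_iff F p, FiniteField.cast_card_eq_zero]
    rw [Finset.sum_const, Finset.card_univ, Fintype.card_units, nsmul_eq_mul, mul_one,
      Nat.cast_sub Fintype.card_pos, h3]
    simp
  rw [Prod.neg_mk, h2] at h1
  exact h1

theorem isIntegral_mulChar (χ : MulChar F (AlgebraicClosure ℚ)) (x : F) : IsIntegral ℤ (χ x) := by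
  classical
  by_cases hx : IsUnit x
  · obtain ⟨u, rfl⟩ := hx
    refine IsIntegral.of_pow (n := Fintype.card Fˣ) Fintype.card_pos ?_
    rw [← map_pow, ← Units.val_pow_eq_pow_val, pow_card_eq_one, Units.val_one, map_one]
    exact isIntegral_one
  · rw [χ.map_nonunit hx]
    exact isIntegral_zero

/-- Every ψ(x) reduces to 1, so the Gauss sum has the same residue as ∑ χ(x), which is 0. -/
theorem gaussSum_mem_reductionGraph [CharP k p] (ψ : AddChar F (AlgebraicClosure ℚ))
    {χ : MulChar F (AlgebraicClosure ℚ)} (hχ : χ ≠ 1) :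
    (gaussSum χ ψ, (0 : k)) ∈ reductionGraph red := by
  choose g hg using fun x => exists_mem_reductionGraph (red := red) (isIntegral_mulChar χ x)
  have h1 := sum_mem_reductionGraph (Finset.univ : Finset F) fun x _ => hg x
  rw [MulChar.sum_eq_zero_of_ne_one hχ] at h1
  have h2 := sum_mem_reductionGraph (Finset.univ : Finset F) (f := fun x => χ x * ψ x) (g := g)
    fun x _ => by
      simpa using mul_mem (hg x)
        (mem_reductionGraph_of_pow_eq_one (addChar_pow_char (p := p) ψ x))
  rwa [eq_zero_of_mem_reductionGraph h1] at h2

/-- With q ≡ 0 the recursion becomes multiplication by K ≡ 1. The index starts at 1 because the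
Dickson polynomial of index 0 is the constant 2. -/
theorem eval_dickson_mem_reductionGraph {q K : AlgebraicClosure ℚ}
    (hq : (q, (0 : k)) ∈ reductionGraph red) (hK : (K, (1 : k)) ∈ reductionGraph red) (N : ℕ) :
    (eval K (dickson 1 q (N + 1)), (1 : k)) ∈ reductionGraph red := by
  induction N using Nat.twoStepInduction with
  | zero => simpa using hK
  | one =>
    have h2 : ((2 : AlgebraicClosure ℚ), (2 : k)) ∈ reductionGraph red := by
      simpa using natCast_mem_reductionGraph (red := red) 2
    have := sub_mem (mul_mem hK hK) (mul_mem hq h2)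
    simp only [Prod.mk_mul_mk, Prod.mk_sub_mk, mul_one, zero_mul, sub_zero] at this
    convert this using 2
    rw [dickson_two, eval_sub, eval_mul, eval_pow, eval_X, eval_C, eval_sub, eval_natCast,
      eval_ofNat, Nat.cast_one]
    ring
  | more N h1 h2 =>
    have := sub_mem (mul_mem hK h2) (mul_mem hq h1)
    simp only [Prod.mk_mul_mk, Prod.mk_sub_mk, mul_one, sub_zero] at this
    convert this using 2
    rw [show N + 2 + 1 = N + 1 + 2 by ring, dickson_add_two]
    simp

end ReductionGraph

/-! ### Conjugates and absolute values of Gauss sums. -/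

section GaussSums

variable {F : Type*} [Field F] [Fintype F]

theorem norm_mul_cos_argTwoPi (z : ℂ) : ‖z‖ * Real.cos (argTwoPi z) = z.re := by
  rw [argTwoPi, ← self_sub_toIcoDiv_zsmul, zsmul_eq_mul, Real.cos_sub_int_mul_two_pi]
  exact Complex.norm_mul_cos_arg z

theorem map_gaussSum_inv (ι : AlgebraicClosure ℚ →+* ℂ) (χ : MulChar F (AlgebraicClosure ℚ))
    (ψ : AddChar F (AlgebraicClosure ℚ)) :
    ι (gaussSum χ⁻¹ ψ⁻¹) = (starRingEnd ℂ) (ι (gaussSum χ ψ)) := by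
  simp only [gaussSum, map_sum, map_mul]
  refine Finset.sum_congr rfl fun x _ => ?_
  have h1 : ι (χ⁻¹ x) = (starRingEnd ℂ) (ι (χ x)) := by
    have := MulChar.star_apply (χ.ringHomComp ι) x
    rw [MulChar.star_eq_inv, MulChar.ringHomComp_inv] at this
    exact this
  have h2 : ι (ψ⁻¹ x) = (starRingEnd ℂ) (ι (ψ x)) := by
    have := AddChar.map_neg_eq_conj ((ι : AlgebraicClosure ℚ →* ℂ).compAddChar ψ) x
    rw [AddChar.inv_apply]
    exact this
  rw [h1, h2]

theorem norm_map_gaussSum (ι : AlgebraicClosure ℚ →+* ℂ) {χ : MulChar F (AlgebraicClosure ℚ)}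
    (hχ : χ ≠ 1) {ψ : AddChar F (AlgebraicClosure ℚ)} (hψ : ψ ≠ 1) :
    ‖ι (gaussSum χ ψ)‖ = √(Fintype.card F : ℝ) := by
  have h := congrArg ι (gaussSum_mul_gaussSum_eq_card hχ (AddChar.IsPrimitive.of_ne_one hψ))
  rw [map_mul, map_gaussSum_inv, Complex.mul_conj, map_natCast] at h
  rw [Complex.norm_def]
  congr 1
  exact_mod_cast h

end GaussSums

/-! ### Nonvanishing and lower bounds for the two algebraic integers. -/

section Angles

variable {F : Type*} [Field F] [Fintype F] [DecidableEq F] {p : ℕ} [Fact p.Prime] [CharP F p]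

theorem map_kloostermanSum {R S : Type*} [CommRing R] [CommRing S] (f : R →+* S)
    (ψ : AddChar F R) (α : Fˣ) :
    f (kloostermanSum ψ α) = kloostermanSum ((f : R →* S).compAddChar ψ) α := by
  simp [kloostermanSum]

theorem compAddChar_ne_one {A R S : Type*} [AddMonoid A] [CommRing R] [CommRing S] (f : R →+* S)
    (hf : Function.Injective f) {ψ : AddChar A R} (hψ : ψ ≠ 1) :
    (f : R →* S).compAddChar ψ ≠ 1 := by
  obtain ⟨c, hc⟩ := AddChar.ne_one_iff.mp hψ
  refine AddChar.ne_one_iff.mpr ⟨c, fun h => hc (hf ?_)⟩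
  rw [map_one]
  exact h

theorem kloostermanSum_eq_cos_kloostermanAngle (hp3 : 3 ≤ p) (ι : AlgebraicClosure ℚ →+* ℂ)
    {ψ : AddChar F (AlgebraicClosure ℚ)} (hψ : ψ ≠ 1) (α : Fˣ) : ι (kloostermanSum ψ α) =
      ((2 * √(Fintype.card F : ℝ) * Real.cos (kloostermanAngle ι ψ α) : ℝ) : ℂ) := by
  have hpos : 0 < 2 * √(Fintype.card F : ℝ) := by
    have : (0 : ℝ) < Fintype.card F := by exact_mod_cast Fintype.card_pos
    positivity
  have hle : |(ι (kloostermanSum ψ α)).re| ≤ 2 * √(Fintype.card F : ℝ) := by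
    rw [map_kloostermanSum]
    exact abs_re_kloostermanSum_le hp3 _ (compAddChar_ne_one ι ι.injective hψ) α
  have hreal : ((ι (kloostermanSum ψ α)).re : ℂ) = ι (kloostermanSum ψ α) := by
    rw [map_kloostermanSum]
    exact Complex.conj_eq_iff_re.mp (conj_kloostermanSum _ α)
  obtain ⟨h1, h2⟩ := abs_le.mp hle
  rw [kloostermanAngle, Real.cos_arccos, mul_div_cancel₀ _ hpos.ne', hreal]
  · rw [le_div_iff₀ hpos]; linarith
  · rw [div_le_one hpos]; exact h2

theorem map_eval_dickson {R S : Type*} [CommRing R] [CommRing S] (f : R →+* S) (a x : R) (n : ℕ) :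
    f (eval x (dickson 1 a n)) = eval (f x) (dickson 1 (f a) n) := by
  rw [← map_dickson, eval_map, eval₂_hom]

/-- Dickson polynomials send u + v to u^n + v^n when uv = r²; here u and v are r·exp(±iθ). They
multiply the angle by n without leaving the ring generated by the Kloosterman sum and q. -/
theorem eval_dickson_cos (r θ : ℝ) (n : ℕ) :
    eval (2 * r * Real.cos θ) (dickson 1 (r ^ 2) n) = 2 * r ^ n * Real.cos (n * θ) := by
  induction n using Nat.twoStepInduction with
  | zero => simp; norm_num
  | one => simp
  | more n h1 h2 =>
    rw [dickson_add_two, eval_sub, eval_mul, eval_mul, eval_X, eval_C, h1, h2]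
    have h3 : Real.cos ((n + 2 : ℕ) * θ) =
        2 * Real.cos θ * Real.cos ((n + 1 : ℕ) * θ) - Real.cos (n * θ) := by
      have e1 : ((n + 2 : ℕ) : ℝ) * θ = (n + 1 : ℕ) * θ + θ := by push_cast; ring
      have e2 : (n : ℝ) * θ = (n + 1 : ℕ) * θ - θ := by push_cast; ring
      rw [e1, e2, Real.cos_add, Real.cos_sub]
      ring
    rw [h3]
    ring

/-- The angle of a Kloosterman sum is far from rational multiples of `π`. -/
theorem one_le_mul_abs_sin_kloostermanAngle (hp3 : 3 ≤ p) (ι : AlgebraicClosure ℚ →+* ℂ)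
    {ψ : AddChar F (AlgebraicClosure ℚ)} (hψ : ψ ≠ 1) (α : Fˣ) {N : ℕ} (hN : 1 ≤ N) :
    1 ≤ (2 * √(Fintype.card F : ℝ) ^ N) ^ p * |Real.sin (N * kloostermanAngle ι ψ α)| := by
  have hp : p.Prime := Fact.out
  set q : ℕ := Fintype.card F with hq
  have hq1 : (1 : ℝ) ≤ q := by exact_mod_cast Fintype.card_pos
  have hsq : √(q : ℝ) ^ 2 = q := Real.sq_sqrt (by linarith)
  set s := eval (kloostermanSum ψ α) (dickson 1 (q : AlgebraicClosure ℚ) N) with hs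
  -- This is (u^N - v^N)² for the roots u, v of the L-function, so it stays in the field of the
  -- Kloosterman sum and detects sin(Nθ).
  set η := s ^ 2 - 4 * (q : AlgebraicClosure ℚ) ^ N with hη
  obtain ⟨k, _, red, hk⟩ := exists_reduction p
  have hqred : ((q : AlgebraicClosure ℚ), (0 : k)) ∈ reductionGraph red :=
    card_mem_reductionGraph F (p := p)
  have hηred : (η, (1 : k)) ∈ reductionGraph red := by
    have h1 := eval_dickson_mem_reductionGraph hqred
      (kloostermanSum_mem_reductionGraph (red := red) (p := p) ψ α) (N - 1)
    rw [Nat.sub_add_cancel hN] at h1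
    have h4 : ((4 : AlgebraicClosure ℚ), (4 : k)) ∈ reductionGraph red := by
      simpa using natCast_mem_reductionGraph (red := red) 4
    have := sub_mem (pow_mem h1 2) (mul_mem h4 (pow_mem hqred N))
    simpa [show N ≠ 0 by omega] using this
  have hη0 : η ≠ 0 := by
    intro h0
    rw [h0] at hηred
    exact one_ne_zero (eq_zero_of_mem_reductionGraph hηred)
  have hval : ∀ ι : AlgebraicClosure ℚ →+* ℂ, ‖ι η‖ =
      4 * (q : ℝ) ^ N * Real.sin (N * kloostermanAngle ι ψ α) ^ 2 := by
    intro ι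
    have h1 : ι s = ((2 * √(q : ℝ) ^ N * Real.cos (N * kloostermanAngle ι ψ α) : ℝ) : ℂ) := by
      rw [hs, map_eval_dickson, kloostermanSum_eq_cos_kloostermanAngle hp3 ι hψ α,
        ← eval_dickson_cos, hsq]
      have := map_eval_dickson Complex.ofRealHom (q : ℝ)
        (2 * √(q : ℝ) * Real.cos (kloostermanAngle ι ψ α)) N
      simpa using this.symm
    have h2 : ι η = ((-(4 * (q : ℝ) ^ N * Real.sin (N * kloostermanAngle ι ψ α) ^ 2) : ℝ) : ℂ) := by
      rw [hη, map_sub, map_pow, h1, Real.sin_sq]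
      push_cast
      simp only [map_mul, map_pow, map_natCast, map_ofNat]
      have h3 : ((q : ℕ) : ℂ) = (√(q : ℝ) : ℂ) ^ 2 := by exact_mod_cast hsq.symm
      rw [h3]
      ring
    rw [h2, Complex.norm_real, norm_neg, Real.norm_of_nonneg (by positivity)]
  have hB : 1 ≤ 4 * (q : ℝ) ^ N := by
    have := one_le_pow₀ hq1 (n := N)
    linarith
  obtain ⟨K, hKfin, hKrank, hK⟩ := exists_intermediateField_rootsOfUnity p hp.ne_zero
  have hKl : kloostermanSum ψ α ∈ K :=
    neg_mem (sum_mem fun x _ => hK _ (addChar_pow_char ψ _))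
  have hsK : s ∈ K := by
    have := map_eval_dickson K.val.toRingHom (q : K) ⟨kloostermanSum ψ α, hKl⟩ N
    have h2 : s = K.val.toRingHom
        (eval (⟨kloostermanSum ψ α, hKl⟩ : K) (dickson 1 (q : K) N)) := by
      rw [this, map_natCast]
      rfl
    rw [h2]
    exact SetLike.coe_mem _
  have hηK : η ∈ K :=
    sub_mem (pow_mem hsK 2) (mul_mem (ofNat_mem K 4) (pow_mem (natCast_mem K q) N))
  have hmain := one_le_norm_mul_pow_of_isIntegral (isIntegral_of_mem_reductionGraph hηred) hη0 K hηK
    hB hKrank (fun ι => by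
      rw [hval]
      exact mul_le_of_le_one_right (by positivity) (Real.sin_sq_le_one _)) ι
  rw [hval] at hmain
  set S := Real.sin (N * kloostermanAngle ι ψ α) with hS
  -- The norm bound involves sin², so it is the square of the desired inequality.
  have h1 : 1 ≤ ((2 * √(q : ℝ) ^ N) ^ p * |S|) ^ 2 := by
    refine hmain.trans (le_of_eq ?_)
    rw [mul_pow _ |S|, sq_abs, ← pow_mul, mul_comm p 2, pow_mul, mul_pow 2, ← pow_mul, mul_comm N 2,
      pow_mul √(q : ℝ), hsq]
    obtain ⟨m, rfl⟩ : ∃ m, p = m + 1 := ⟨p - 1, by omega⟩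
    rw [Nat.add_sub_cancel, pow_succ]
    ring
  rw [one_le_sq_iff₀ (by positivity)] at h1
  exact h1

/-- The angles of a Kloosterman sum and of a Gauss sum are far from each other. -/
theorem one_le_mul_abs_cos_sub_cos (hp3 : 3 ≤ p) (ι : AlgebraicClosure ℚ →+* ℂ)
    {ψ ψ' : AddChar F (AlgebraicClosure ℚ)} (hψ : ψ ≠ 1) (hψ' : ψ' ≠ 1) (α : Fˣ)
    {χ : MulChar F (AlgebraicClosure ℚ)} (hχ : χ ≠ 1) {n : ℕ} (hn : 1 ≤ n) (hord : orderOf χ = n) :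
    1 ≤ (4 * √(Fintype.card F : ℝ)) ^ (n * p) *
      |Real.cos (kloostermanAngle ι ψ α) - Real.cos (gaussAngle ι χ ψ')| := by
  have hp : p.Prime := Fact.out
  set q : ℕ := Fintype.card F with hq
  have hq1 : (1 : ℝ) ≤ √(q : ℝ) := by
    rw [Real.one_le_sqrt]
    exact_mod_cast Fintype.card_pos
  -- The plus sign appears because `gaussSum` is unsigned. Adding the inverse characters adds the
  -- complex conjugate in every embedding at once.
  set η := kloostermanSum ψ α + (gaussSum χ ψ' + gaussSum χ⁻¹ ψ'⁻¹) with hη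
  obtain ⟨k, _, red, hk⟩ := exists_reduction p
  have hχ' : χ⁻¹ ≠ 1 := inv_ne_one.mpr hχ
  have hηred : (η, (1 : k)) ∈ reductionGraph red := by
    have := add_mem (kloostermanSum_mem_reductionGraph (red := red) (p := p) ψ α)
      (add_mem (gaussSum_mem_reductionGraph (red := red) (p := p) ψ' hχ)
        (gaussSum_mem_reductionGraph (red := red) (p := p) ψ'⁻¹ hχ'))
    simpa using this
  have hη0 : η ≠ 0 := by
    intro h0
    rw [h0] at hηred
    exact one_ne_zero (eq_zero_of_mem_reductionGraph hηred)
  have hval : ∀ ι : AlgebraicClosure ℚ →+* ℂ, ‖ι η‖ =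
      2 * √(q : ℝ) * |Real.cos (kloostermanAngle ι ψ α) - Real.cos (gaussAngle ι χ ψ')| := by
    intro ι
    have h1 := norm_mul_cos_argTwoPi (ι (signedGaussSum χ ψ'))
    have h2 : ‖ι (signedGaussSum χ ψ')‖ = √(q : ℝ) := by
      rw [signedGaussSum, map_neg, norm_neg, norm_map_gaussSum ι hχ hψ']
    rw [h2] at h1
    have h3 : ι (gaussSum χ ψ' + gaussSum χ⁻¹ ψ'⁻¹) =
        ((-(2 * (√(q : ℝ) * Real.cos (gaussAngle ι χ ψ'))) : ℝ) : ℂ) := by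
      rw [map_add, map_gaussSum_inv, Complex.add_conj, gaussAngle, h1, signedGaussSum, map_neg,
        Complex.neg_re]
      push_cast
      ring
    rw [hη, map_add, h3, kloostermanSum_eq_cos_kloostermanAngle hp3 ι hψ α, ← Complex.ofReal_add,
      Complex.norm_real, Real.norm_eq_abs, ← abs_of_nonneg (show 0 ≤ 2 * √(q : ℝ) by positivity),
      ← abs_mul, abs_of_nonneg (show 0 ≤ 2 * √(q : ℝ) by positivity)]
    congr 1
    ring
  obtain ⟨K, hKfin, hKrank, hK⟩ := exists_intermediateField_rootsOfUnity (n * p)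
    (mul_ne_zero (by omega) hp.ne_zero)
  have hψK : ∀ (ψ : AddChar F (AlgebraicClosure ℚ)) x, ψ x ∈ K := fun ψ x =>
    hK _ (by rw [mul_comm, pow_mul, addChar_pow_char, one_pow])
  have hχK : ∀ χ' : MulChar F (AlgebraicClosure ℚ), orderOf χ' = n → ∀ x, χ' x ∈ K := by
    intro χ' h x
    by_cases hx : IsUnit x
    · obtain ⟨u, rfl⟩ := hx
      apply hK
      rw [pow_mul, ← MulChar.pow_apply_coe, ← h, pow_orderOf_eq_one, MulChar.one_apply_coe, one_pow]
    · rw [χ'.map_nonunit hx]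
      exact zero_mem K
  have hηK : η ∈ K := by
    refine add_mem (neg_mem (sum_mem fun x _ => hψK _ _)) (add_mem ?_ ?_)
    · exact sum_mem fun x _ => mul_mem (hχK χ hord x) (hψK _ _)
    · exact sum_mem fun x _ => mul_mem (hχK χ⁻¹ ((orderOf_inv χ).trans hord) x) (hψK _ _)
  have hmain := one_le_norm_mul_pow_of_isIntegral (isIntegral_of_mem_reductionGraph hηred) hη0 K hηK
    (B := 4 * √(q : ℝ)) (by linarith) hKrank (fun ι => by
      rw [hval]
      have h1 : |Real.cos (kloostermanAngle ι ψ α) - Real.cos (gaussAngle ι χ ψ')| ≤ 2 := by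
        rw [abs_le]
        constructor <;> linarith [Real.cos_le_one (kloostermanAngle ι ψ α),
          Real.neg_one_le_cos (kloostermanAngle ι ψ α), Real.cos_le_one (gaussAngle ι χ ψ'),
          Real.neg_one_le_cos (gaussAngle ι χ ψ')]
      nlinarith) ι
  rw [hval] at hmain
  refine hmain.trans ?_
  obtain ⟨m, hm⟩ : ∃ m, n * p = m + 1 :=
    ⟨n * p - 1, by have := Nat.mul_pos hn hp.pos; omega⟩
  rw [hm, Nat.add_sub_cancel, pow_succ]
  set T := |Real.cos (kloostermanAngle ι ψ α) - Real.cos (gaussAngle ι χ ψ')|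
  have hT : 0 ≤ T := abs_nonneg _
  have h4 : 0 ≤ √(q : ℝ) * T * (4 * √(q : ℝ)) ^ m := by positivity
  linarith

end Angles

/-! ### Comparison with the exponents τ and σ. -/

section Exponents

theorem log_two_div_log_three_pos : 0 < Real.log 2 / Real.log 3 :=
  div_pos (Real.log_pos (by norm_num)) (Real.log_pos (by norm_num))

theorem tauExponent_pos {p N : ℕ} (hp : 3 ≤ p) (hN : 1 ≤ N) : 0 < tauExponent p N := by
  have h1 := log_two_div_log_three_pos
  have h2 : (3 : ℝ) ≤ p := by exact_mod_cast hp
  have h3 : (1 : ℝ) ≤ N := by exact_mod_cast hN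
  have h4 : 0 ≤ Real.log N / Real.log 3 :=
    div_nonneg (Real.log_nonneg h3) (Real.log_nonneg (by norm_num))
  have h5 : 0 < 2 * ((p : ℝ) - 1) * (Real.log 2 / Real.log 3 + (N : ℝ) / 2) :=
    mul_pos (by linarith) (by linarith)
  rw [tauExponent]
  linarith

theorem le_sigmaExponent {p n : ℕ} (hp : 3 ≤ p) :
    2 * (n : ℝ) * p * (Real.log 2 / Real.log 3 + 3 * ((p : ℝ) - 1) + 1) ≤ sigmaExponent p n := by
  have h1 := log_two_div_log_three_pos
  have h2 : (3 : ℝ) ≤ p := by exact_mod_cast hp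
  rw [sigmaExponent, mul_div_assoc 2]
  refine mul_le_mul_of_nonneg_left ?_ (by positivity)
  have h3 : 0 ≤ ((p : ℝ) - 1) * (Real.log 2 / Real.log 3) := mul_nonneg (by linarith) h1.le
  linarith

theorem sigmaExponent_pos {p n : ℕ} (hp : 3 ≤ p) (hn : 1 ≤ n) : 0 < sigmaExponent p n := by
  have h1 := log_two_div_log_three_pos
  have h2 : (3 : ℝ) ≤ p := by exact_mod_cast hp
  have h3 : (1 : ℝ) ≤ n := by exact_mod_cast hn
  refine lt_of_lt_of_le (mul_pos (by positivity) ?_) (le_sigmaExponent hp)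
  linarith

theorem tauExponent_one_le_sigmaExponent_one {p : ℕ} (hp : 3 ≤ p) :
    tauExponent p 1 ≤ sigmaExponent p 1 := by
  have h1 := log_two_div_log_three_pos
  have h2 : (3 : ℝ) ≤ p := by exact_mod_cast hp
  refine le_trans ?_ (le_sigmaExponent hp)
  rw [tauExponent, Nat.cast_one, Real.log_one, zero_div, add_zero, mul_one]
  exact mul_le_mul (by linarith) (by linarith) (by linarith) (by linarith)

/-- After taking logarithms, p ≤ 2(p - 1) handles the powers, and log q / log 3 ≥ 1 absorbs the
constants log 2 and log N. -/
theorem le_rpow_tauExponent {p N : ℕ} {q : ℝ} (hp : 3 ≤ p) (hN : 1 ≤ N) (hq : 3 ≤ q) :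
    (2 * √q ^ N) ^ p * N ≤ q ^ tauExponent p N := by
  have h2 : (3 : ℝ) ≤ p := by exact_mod_cast hp
  have h3 : (1 : ℝ) ≤ N := by exact_mod_cast hN
  have hq0 : 0 < q := by linarith
  have hs : 0 < √q := Real.sqrt_pos.mpr hq0
  have hc : 0 < Real.log 3 := Real.log_pos (by norm_num)
  rw [Real.le_rpow_iff_log_le (by positivity) hq0, Real.log_mul (by positivity) (by positivity),
    Real.log_pow, Real.log_mul (by norm_num) (by positivity), Real.log_pow, Real.log_sqrt hq0.le,
    tauExponent]
  set ρ := Real.log q / Real.log 3 with hρ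
  have hρ1 : 1 ≤ ρ := (one_le_div hc).mpr (Real.log_le_log (by norm_num) hq)
  have hl2 : 0 < Real.log 2 := Real.log_pos (by norm_num)
  have hlN : 0 ≤ Real.log N := Real.log_nonneg h3
  have hlq : 0 < Real.log q := Real.log_pos (by linarith)
  have e : (2 * ((p : ℝ) - 1) * (Real.log 2 / Real.log 3 + (N : ℝ) / 2) +
      Real.log N / Real.log 3) * Real.log q =
      2 * ((p : ℝ) - 1) * (Real.log 2 * ρ + N * (Real.log q / 2)) + Real.log N * ρ := by
    rw [hρ]; ring
  rw [e]
  have h5 : Real.log 2 ≤ Real.log 2 * ρ := le_mul_of_one_le_right hl2.le hρ1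
  have h6 : Real.log N ≤ Real.log N * ρ := le_mul_of_one_le_right hlN hρ1
  have h7 : 0 ≤ N * (Real.log q / 2) := by positivity
  have h8 : (p : ℝ) * (Real.log 2 + N * (Real.log q / 2)) ≤
      2 * ((p : ℝ) - 1) * (Real.log 2 * ρ + N * (Real.log q / 2)) :=
    mul_le_mul (by linarith) (by linarith) (by linarith) (by linarith)
  linarith

/-- There is ample room: 4√q ≤ q³ already gives the exponent 3np, well below σ. -/
theorem le_rpow_sigmaExponent {p n : ℕ} {q : ℝ} (hp : 3 ≤ p) (hq : 3 ≤ q) :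
    (4 * √q) ^ (n * p) ≤ q ^ sigmaExponent p n := by
  have h2 : (3 : ℝ) ≤ p := by exact_mod_cast hp
  have hsq : √q ≤ q := by
    rw [Real.sqrt_le_left (by linarith)]
    nlinarith
  have h4 : 4 * √q ≤ q ^ 3 := by
    have h5 : 4 ≤ q ^ 2 := by nlinarith
    calc 4 * √q ≤ q ^ 2 * q := by gcongr
      _ = q ^ 3 := by ring
  calc (4 * √q) ^ (n * p) ≤ (q ^ 3) ^ (n * p) := by gcongr
    _ = q ^ ((3 * (n * p) : ℕ) : ℝ) := by rw [Real.rpow_natCast, pow_mul q]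
    _ ≤ q ^ sigmaExponent p n := by
      refine Real.rpow_le_rpow_of_exponent_le (by linarith) (le_trans ?_ (le_sigmaExponent hp))
      have h1 := log_two_div_log_three_pos
      push_cast
      have : (0 : ℝ) ≤ n * p := by positivity
      nlinarith

theorem rpow_neg_le_of_one_le_mul {q A e δ : ℝ} (hq : 0 < q) (hA : A ≤ q ^ e) (hδ : 0 ≤ δ)
    (h : 1 ≤ A * δ) : q ^ (-e) ≤ δ := by
  rw [Real.rpow_neg hq.le, inv_le_iff_one_le_mul₀' (Real.rpow_pos_of_pos hq e)]
  exact h.trans (mul_le_mul_of_nonneg_right hA hδ)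

end Exponents

/-! ### From trigonometric bounds to distances between angles. -/

section Main

theorem three_le_card (F : Type*) [Field F] [Fintype F] (p : ℕ) [CharP F p]
    (hp3 : 3 ≤ p) : (3 : ℝ) ≤ Fintype.card F := by
  obtain ⟨f, -, hf⟩ := FiniteField.card F p
  rw [hf]
  exact_mod_cast hp3.trans (Nat.le_self_pow f.ne_zero p)

variable {F : Type*} [Field F] [Fintype F] [DecidableEq F] {p : ℕ} [Fact p.Prime] [CharP F p]

theorem le_infEDist_rootOfUnityAngles (hp3 : 3 ≤ p) (ι : AlgebraicClosure ℚ →+* ℂ)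
    {ψ : AddChar F (AlgebraicClosure ℚ)} (hψ : ψ ≠ 1) (α : Fˣ) {N : ℕ} (hN : 1 ≤ N) {φ : ℝ}
    (hφ : φ = kloostermanAngle ι ψ α ∨ φ = 2 * Real.pi - kloostermanAngle ι ψ α) :
    ENNReal.ofReal ((Fintype.card F : ℝ) ^ (-tauExponent p N)) ≤
      Metric.infEDist φ (rootOfUnityAngles N) := by
  have hq3 := three_le_card F p hp3
  have hN0 : (N : ℝ) ≠ 0 := by positivity
  rw [Metric.le_infEDist]
  rintro y ⟨j, -, rfl⟩
  rw [edist_dist, Real.dist_eq]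
  refine ENNReal.ofReal_le_ofReal (rpow_neg_le_of_one_le_mul (by linarith)
    (le_rpow_tauExponent hp3 hN hq3) (abs_nonneg _) ?_)
  refine (one_le_mul_abs_sin_kloostermanAngle (p := p) hp3 ι hψ α hN).trans ?_
  rw [mul_assoc]
  refine mul_le_mul_of_nonneg_left ?_ (by positivity)
  have h1 : |Real.sin (N * kloostermanAngle ι ψ α)| = |Real.sin (N * φ)| := by
    rcases hφ with rfl | rfl
    · rfl
    · rw [mul_sub, Real.sin_nat_mul_two_pi_sub, abs_neg]
  -- Shifting Nφ by 2πj turns the sine into that of N times the distance to 2πj/N; the Lipschitz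
  -- bound then yields the factor N absorbed by τ.
  rw [h1, ← Real.sin_sub_nat_mul_two_pi _ j]
  have h2 := Real.abs_sin_sub_sin_le (N * φ - j * (2 * Real.pi)) 0
  rw [Real.sin_zero, sub_zero, sub_zero] at h2
  refine h2.trans (le_of_eq ?_)
  rw [← abs_of_nonneg (Nat.cast_nonneg (α := ℝ) N), ← abs_mul,
    abs_of_nonneg (Nat.cast_nonneg (α := ℝ) N)]
  congr 1
  field_simp

theorem le_infEDist_gaussAngles (hp3 : 3 ≤ p) (ι : AlgebraicClosure ℚ →+* ℂ)
    {ψ : AddChar F (AlgebraicClosure ℚ)} (hψ : ψ ≠ 1) (α : Fˣ) {n : ℕ} (hn : 1 ≤ n) {φ : ℝ}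
    (hφ : φ = kloostermanAngle ι ψ α ∨ φ = 2 * Real.pi - kloostermanAngle ι ψ α) :
    ENNReal.ofReal ((Fintype.card F : ℝ) ^ (-sigmaExponent p n)) ≤
      Metric.infEDist φ (gaussAngles F ι n) := by
  have hq3 := three_le_card F p hp3
  rw [Metric.le_infEDist]
  rintro y ⟨χ, ψ', hord, hψ', rfl⟩
  by_cases hχ : χ = 1
  -- For trivial χ the signed Gauss sum is 1, with neither residue 0 nor absolute value √q. Its
  -- angle 0 is the only root of unity angle for N = 1, and τ ≤ σ there.
  · subst hχ
    rw [orderOf_one] at hord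
    subst hord
    have hangle : gaussAngle ι (1 : MulChar F (AlgebraicClosure ℚ)) ψ' = 0 := by
      rw [gaussAngle, signedGaussSum, gaussSum_one_left hψ', neg_neg, map_one, argTwoPi,
        Complex.arg_one, toIcoMod_apply_left]
    have h1 := Metric.le_infEDist.mp
      (le_infEDist_rootOfUnityAngles (p := p) hp3 ι hψ α le_rfl hφ) 0 ⟨0, one_pos, by simp⟩
    rw [hangle]
    refine le_trans (ENNReal.ofReal_le_ofReal ?_) h1
    exact Real.rpow_le_rpow_of_exponent_le (by linarith)
      (neg_le_neg (tauExponent_one_le_sigmaExponent_one hp3))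
  · rw [edist_dist, Real.dist_eq]
    refine ENNReal.ofReal_le_ofReal (rpow_neg_le_of_one_le_mul (by linarith)
      (le_rpow_sigmaExponent hp3 hq3) (abs_nonneg _) ?_)
    refine (one_le_mul_abs_cos_sub_cos (p := p) hp3 ι hψ hψ' α hχ hn hord).trans ?_
    refine mul_le_mul_of_nonneg_left ?_ (by positivity)
    have h1 : Real.cos (kloostermanAngle ι ψ α) = Real.cos φ := by
      rcases hφ with rfl | rfl
      · rfl
      · rw [Real.cos_two_pi_sub]
    rw [h1]
    exact Real.abs_cos_sub_cos_le _ _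

end Main

theorem mainTheorem8 (p N n : ℕ) (hp : p.Prime) (hp3 : 3 ≤ p) (hN : 1 ≤ N) (hn : 1 ≤ n)
    (hnp : n.Coprime p) :
    0 < tauExponent p N ∧ 0 < sigmaExponent p n ∧
      ∀ (F : Type*) [Field F] [Fintype F] [DecidableEq F] [CharP F p]
        (ι : AlgebraicClosure ℚ →+* ℂ) (ψ : AddChar F (AlgebraicClosure ℚ)) (α : Fˣ), ψ ≠ 1 →
        -- the Kloosterman angle is well defined
        ι (kloostermanSum ψ α) =
            ((2 * √(Fintype.card F : ℝ) * Real.cos (kloostermanAngle ι ψ α) : ℝ) : ℂ) ∧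
        -- `Metric.infEDist` is the infimum of the distances, and `⊤` for the empty set
        ENNReal.ofReal ((Fintype.card F : ℝ) ^ (-tauExponent p N)) ≤
          min (Metric.infEDist (kloostermanAngle ι ψ α) (rootOfUnityAngles N))
            (Metric.infEDist (2 * Real.pi - kloostermanAngle ι ψ α) (rootOfUnityAngles N)) ∧
        ENNReal.ofReal ((Fintype.card F : ℝ) ^ (-sigmaExponent p n)) ≤
          min (Metric.infEDist (kloostermanAngle ι ψ α) (gaussAngles F ι n))
            (Metric.infEDist (2 * Real.pi - kloostermanAngle ι ψ α) (gaussAngles F ι n)) := by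
  have : Fact p.Prime := ⟨hp⟩
  refine ⟨tauExponent_pos hp3 hN, sigmaExponent_pos hp3 hn, ?_⟩
  intro F _ _ _ _ ι ψ α hψ
  exact ⟨kloostermanSum_eq_cos_kloostermanAngle (p := p) hp3 ι hψ α,
    le_min (le_infEDist_rootOfUnityAngles hp3 ι hψ α hN (Or.inl rfl))
      (le_infEDist_rootOfUnityAngles hp3 ι hψ α hN (Or.inr rfl)),
    le_min (le_infEDist_gaussAngles hp3 ι hψ α hn (Or.inl rfl))
      (le_infEDist_gaussAngles hp3 ι hψ α hn (Or.inr rfl))⟩
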